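/- **Setting.** Fix real $w_x,w_y,w_z,g_0$ and rates $\gamma_\uparrow,\gamma_\downarrow\ge 0$, $0\le\Gamma_\uparrow<\Gamma_\downarrow$; put $\Gamma_\pm=\Gamma_\uparrow\pm\Gamma_\downarrow$ and $\varepsilon=-\Gamma_- /\Gamma_+>0$. Write $\mathcal W_V[X]=V^\dagger XV-\frac12(V^\dagger VX+XV^\dagger V)$. *Finite system.* On a central spin-$\frac12$ (Pauli matrices $\tau_\alpha$) and $N$ bath spins-$\frac12$ (Pauli matrices $\sigma_\alpha^{(k)}$), with $\sigma_-=|\!\downarrow\rangle\langle\uparrow\!|$, $\sigma_+=\sigma_-^\dagger$, likewise $\tau_\pm$, and $S_\pm=\sum_{k=1}^N\sigma_\pm^{(k)}$, let $$H=\sum_\alpha w_\alpha\tau_\alpha+\frac{g_0}{\sqrt N}(\tau_+S_-+\tau_-S_+),$$ $$\mathcal L[X]=i[H,X]+\gamma_\downarrow\mathcal W_{\tau_-}[X]+\gamma_\uparrow\mathcal W_{\tau_+}[X]+\sum_{k=1}^N\bigl(\Gamma_\downarrow\mathcal W_{\sigma_-^{(k)}}[X]+\Gamma_\uparrow\mathcal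 W_{\sigma_+^{(k)}}[X]\bigr).$$ Let $a_N=S_- /\sqrt{\varepsilon N}$, $m_z^N=\frac1N\sum_k\sigma_z^{(k)}$, and for $\vec\mu=(\mu_1,\mu_2,\mu_3,\mu_4)$, with $\tau_{\mu_1}\in\{1,\tau_x,\tau_y,\tau_z\}$ and $\mu_2,\mu_3,\mu_4\in\mathbb N$, let $P_N^{\vec\mu}=\tau_{\mu_1}a_N^{\dagger\,\mu_2}a_N^{\mu_3}(m_z^N)^{\mu_4}$. Let $\Omega_{\rm SS}$ be the product state of the bath, equal on all bath spins, with $\Omega_{\rm SS}(\sigma_z)=\Gamma_- /\Gamma_+$ and $\Omega_{\rm SS}(\sigma_\pm)=0$, and let $\varphi$ be any state of the central spin. *Emergent system.* On the central spin and one bosonic mode with annihilation operator $a$ on the Fock space, let $$\tilde{\mathcal L}[X]=i\Bigl[\sum_\alpha w_\alpha\tau_\alpha+g_0\sqrt\varepsilon(\tau_-a^\dagger+\tau_+a),X\Bigr]+\gamma_\downarrow\mathcal W_{\tau_-}[X]+\gamma_\uparrow\mathcal W_{\tau_+}[X]+\Bigl(\Gamma_++\frac{\Gamma_\uparrow}\varepsilon\Bigr)\mathcal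 W_a[X]+\frac{\Gamma_\uparrow}\varepsilon\mathcal W_{a^\dagger}[X],$$ $P^{\vec\mu}=\tau_{\mu_1}a^{\dagger\,\mu_2}a^{\mu_3}(-\varepsilon)^{\mu_4}$, and $\tilde\Omega_\beta(X)={\rm Tr}(\rho_\beta X)$ with the thermal state $\rho_\beta=(1-e^{-\beta\omega})e^{-\beta\omega a^\dagger a}$, $e^{-\beta\omega}=\Gamma_\uparrow/(\Gamma_+\varepsilon+\Gamma_\uparrow)$ (the vacuum if $\Gamma_\uparrow=0$). Operators on this system are described by their matrix elements in the basis of the spin and the number states, and $e^{t\tilde{\mathcal L}}[X]=\sum_{k\ge0}\frac{t^k}{k!}\tilde{\mathcal L}^k[X]$ is the exponential series, taken in each matrix element. **Claim.** Let $\vec\nu,\vec\mu,\vec\eta$ be multi-indices as above and assume the following. (A1) For all $t\ge0$, the limit $N\to\infty$ can be exchanged with the power series of $e^{t\mathcal L}$: $$\lim_{N\to\infty}\varphi\otimes\Omega_{\rm SS}\bigl(P_N^{\vec\nu}e^{t\mathcal L}[P_N^{\vec\mu}]P_N^{\vec\eta}\bigr)=\sum_{k=0}^\infty\frac{t^k}{k!}\lim_{N\to\infty}\varphi\otimes\Omega_{\rm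 SS}\bigl(P_N^{\vec\nu}\mathcal L^k[P_N^{\vec\mu}]P_N^{\vec\eta}\bigr),$$ that is, if the limits of all the single terms on the right exist, then the series on the right converges, and the limit on the left exists and equals its sum. (A2) For all $t\ge0$, $e^{t\tilde{\mathcal L}}[P^{\vec\mu}]$ and its expectation below exist, and $$\varphi\otimes\tilde\Omega_\beta\bigl(P^{\vec\nu}e^{t\tilde{\mathcal L}}[P^{\vec\mu}]P^{\vec\eta}\bigr)=\sum_{k=0}^\infty\frac{t^k}{k!}\,\varphi\otimes\tilde\Omega_\beta\bigl(P^{\vec\nu}\tilde{\mathcal L}^k[P^{\vec\mu}]P^{\vec\eta}\bigr),$$ where the series converges uniformly for $t$ in compact subsets of $[0,\infty)$. Then for all $t\ge0$ $$\lim_{N\to\infty}\varphi\otimes\Omega_{\rm SS}\bigl(P_N^{\vec\nu}e^{t\mathcal L}[P_N^{\vec\mu}]P_N^{\vec\eta}\bigr)=\varphi\otimes\tilde\Omega_\beta\bigl(P^{\vec\nu}e^{t\tilde{\mathcal L}}[P^{\vec\mu}]P^{\vec\eta}\bigr).$$ -/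

import Mathlib

open Filter Topology Matrix Kronecker
open scoped ComplexOrder

noncomputable section

namespace CentralSpin

/-! ### Single-spin operators; index `0` is spin up, index `1` is spin down -/

/-- The matrices `1, σ_x, σ_y, σ_z`. -/
def pauli : Fin 4 → Matrix (Fin 2) (Fin 2) ℂ :=
  ![1, !![0, 1; 1, 0], !![0, -Complex.I; Complex.I, 0], !![1, 0; 0, -1]]

/-- `σ_- = |down⟩⟨up|`. -/
def lower : Matrix (Fin 2) (Fin 2) ℂ := !![0, 0; 1, 0]

/-- `σ_+`, the adjoint of `σ_-`. -/
def raise : Matrix (Fin 2) (Fin 2) ℂ := lowerᴴ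

/-- The exponential series `e^{tL}[X] = ∑ₖ (tᵏ / k!) Lᵏ[X]`. On matrices, also on infinite ones,
the topology is that of entrywise convergence. -/
def expSeries {V : Type*} [AddCommGroup V] [Module ℂ V] [TopologicalSpace V]
    (L : V → V) (t : ℝ) (X : V) : V :=
  ∑' k : ℕ, ((t ^ k / (k.factorial : ℝ) : ℝ) : ℂ) • (L^[k]) X

/-- Parameters of the model: fields `w_x, w_y, w_z` and rates `γ` of the central spin, rates `Γ` of
the bath spins, and the coupling constant `g₀`. -/
structure Params where
  w : Fin 3 → ℝ
  g₀ : ℝ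
  γUp : ℝ
  γDown : ℝ
  ΓUp : ℝ
  ΓDown : ℝ

/-- `Γ₊ = Γ_up + Γ_down`. -/
def Params.ΓPlus (p : Params) : ℝ := p.ΓUp + p.ΓDown

/-- `Γ₋ = Γ_up - Γ_down`. -/
def Params.ΓMinus (p : Params) : ℝ := p.ΓUp - p.ΓDown

/-- `ε = -Ω_SS(σ_z) = -Γ₋ / Γ₊`. -/
def Params.ε (p : Params) : ℝ := -(p.ΓMinus / p.ΓPlus)

/-- `H_τ = ∑ w_α τ_α`, on the central spin alone. -/
def Params.Hτ (p : Params) : Matrix (Fin 2) (Fin 2) ℂ :=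
  ∑ α : Fin 3, (p.w α : ℂ) • pauli α.succ

/-- The multi-index `(μ₁, μ₂, μ₃, μ₄)` of a monomial: a matrix `1, τ_x, τ_y, τ_z` of the central
spin and the powers of the creation, annihilation and average operators. -/
structure MonIndex where
  spin : Fin 4
  cre : ℕ
  ann : ℕ
  avg : ℕ

/-! ### The system of one central spin and `N` bath spins -/

/-- Basis labels of the bath. -/
abbrev Bath (N : ℕ) : Type := Fin N → Fin 2

/-- Operators of the whole finite system. -/
abbrev FinOp (N : ℕ) : Type := Matrix (Fin 2 × Bath N) (Fin 2 × Bath N) ℂ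

/-- The one-spin operator `A` acting on bath spin `k`, the identity on the other bath spins. -/
def site {N : ℕ} (k : Fin N) (A : Matrix (Fin 2) (Fin 2) ℂ) : Matrix (Bath N) (Bath N) ℂ :=
  Matrix.of fun x y => ∏ j, if j = k then A (x j) (y j) else (1 : Matrix (Fin 2) (Fin 2) ℂ) (x j) (y j)

/-- A central-spin operator on the whole system. -/
def onSpin {N : ℕ} (A : Matrix (Fin 2) (Fin 2) ℂ) : FinOp N := A ⊗ₖ (1 : Matrix (Bath N) (Bath N) ℂ)

/-- A bath operator on the whole system. -/
def onBath {N : ℕ} (B : Matrix (Bath N) (Bath N) ℂ) : FinOp N := (1 : Matrix (Fin 2) (Fin 2) ℂ) ⊗ₖ B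

/-- `S_A = ∑ₖ A^{(k)}`. -/
def collective (N : ℕ) (A : Matrix (Fin 2) (Fin 2) ℂ) : Matrix (Bath N) (Bath N) ℂ :=
  ∑ k : Fin N, site k A

/-- `W_V[X] = V† X V - (V† V X + X V† V) / 2`. -/
def dissipator {n : Type*} [Fintype n] (V X : Matrix n n ℂ) : Matrix n n ℂ :=
  Vᴴ * X * V - (1 / 2 : ℂ) • (Vᴴ * V * X + X * (Vᴴ * V))

/-- `H = H_τ + g (τ₊ S₋ + τ₋ S₊)` with `g = g₀ / √N`. -/
def Params.hamiltonian (p : Params) (N : ℕ) : FinOp N :=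
  onSpin p.Hτ + ((p.g₀ / √(N : ℝ) : ℝ) : ℂ) •
    (onSpin raise * onBath (collective N lower) + onSpin lower * onBath (collective N raise))

/-- The Lindblad generator `𝓛` in the Heisenberg picture. -/
def Params.generator (p : Params) (N : ℕ) (X : FinOp N) : FinOp N :=
  Complex.I • (p.hamiltonian N * X - X * p.hamiltonian N)
    + ((p.γDown : ℂ) • dissipator (onSpin lower) X + (p.γUp : ℂ) • dissipator (onSpin raise) X)
    + ∑ k : Fin N, ((p.ΓDown : ℂ) • dissipator (onBath (site k lower)) X
        + (p.ΓUp : ℂ) • dissipator (onBath (site k raise)) X)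

/-- `a_N = S₋ / √(ε N)`. -/
def Params.aN (p : Params) (N : ℕ) : Matrix (Bath N) (Bath N) ℂ :=
  ((1 / √(p.ε * N) : ℝ) : ℂ) • collective N lower

/-- `m_z^N = S_z / N`. -/
def mz (N : ℕ) : Matrix (Bath N) (Bath N) ℂ := (1 / (N : ℂ)) • collective N (pauli 3)

/-- `P_N^μ = τ_{μ₁} (a_N†)^{μ₂} a_N^{μ₃} (m_z^N)^{μ₄}`. -/
def Params.monN (p : Params) (N : ℕ) (μ : MonIndex) : FinOp N :=
  onSpin (pauli μ.spin) * onBath ((p.aN N)ᴴ ^ μ.cre * p.aN N ^ μ.ann * mz N ^ μ.avg)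

/-- The density matrix of one bath spin in `Ω_SS`: `⟨σ_z⟩ = Γ₋ / Γ₊` and `⟨σ_±⟩ = 0`. -/
def Params.bathSpinState (p : Params) : Matrix (Fin 2) (Fin 2) ℂ :=
  (1 / 2 : ℂ) • (1 + ((p.ΓMinus / p.ΓPlus : ℝ) : ℂ) • pauli 3)

/-- The density matrix of the product state `Ω_SS`. -/
def Params.bathState (p : Params) (N : ℕ) : Matrix (Bath N) (Bath N) ℂ :=
  Matrix.of fun x y => ∏ k, p.bathSpinState (x k) (y k)

/-- `φ ⊗ Ω_SS`, where `φ` is the state with density matrix `ρ`. -/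
def Params.stateN (p : Params) (ρ : Matrix (Fin 2) (Fin 2) ℂ) (N : ℕ) (X : FinOp N) : ℂ :=
  Matrix.trace ((ρ ⊗ₖ p.bathState N) * X)

/-- `φ ⊗ Ω_SS (P_N^ν Y P_N^η)`. -/
def Params.corrN (p : Params) (ρ : Matrix (Fin 2) (Fin 2) ℂ) (N : ℕ) (ν η : MonIndex)
    (Y : FinOp N) : ℂ :=
  p.stateN ρ N (p.monN N ν * Y * p.monN N η)

/-! ### The system of one spin and one bosonic mode

Possibly unbounded operators are represented by their matrix elements in the basis of the spin and
the number states. -/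

/-- Operators (matrices of sesquilinear forms) of the spin-boson system. -/
abbrev BosOp : Type := Matrix (Fin 2 × ℕ) (Fin 2 × ℕ) ℂ

/-- The product of infinite matrices. In all products below at least one factor has only finitely
many nonzero entries in each row and in each column, so that the sum is finite. -/
def opMul {n : Type*} (A B : Matrix n n ℂ) : Matrix n n ℂ :=
  Matrix.of fun i j => ∑' k, A i k * B k j

/-- Powers for `opMul`. -/
def opPow {n : Type*} [DecidableEq n] (A : Matrix n n ℂ) (k : ℕ) : Matrix n n ℂ :=
  (opMul A)^[k] 1

/-- The annihilation operator, `a |n⟩ = √n |n - 1⟩`. Its adjoint `aᴴ` is the creation operator. -/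
def a : Matrix ℕ ℕ ℂ := Matrix.of fun m n => if n = m + 1 then ((√(n : ℝ) : ℝ) : ℂ) else 0

/-- `W_V[X] = V† X V - (V† V X + X V† V) / 2`. -/
def dissipatorInf {n : Type*} (V X : Matrix n n ℂ) : Matrix n n ℂ :=
  opMul (opMul Vᴴ X) V - (1 / 2 : ℂ) • (opMul (opMul Vᴴ V) X + opMul X (opMul Vᴴ V))

/-- A spin operator on the spin-boson system. -/
def spinInf (A : Matrix (Fin 2) (Fin 2) ℂ) : BosOp := A ⊗ₖ (1 : Matrix ℕ ℕ ℂ)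

/-- A bosonic operator on the spin-boson system. -/
def bosInf (B : Matrix ℕ ℕ ℂ) : BosOp := (1 : Matrix (Fin 2) (Fin 2) ℂ) ⊗ₖ B

/-- `H_τ + g₀ √ε (τ₋ a† + τ₊ a)`. -/
def Params.hamiltonianInf (p : Params) : BosOp :=
  spinInf p.Hτ + ((p.g₀ * √p.ε : ℝ) : ℂ) • (lower ⊗ₖ aᴴ + raise ⊗ₖ a)

/-- `κ_down = Γ₊ + Γ_up / ε`. -/
def Params.κDown (p : Params) : ℝ := p.ΓPlus + p.ΓUp / p.ε

/-- `κ_up = Γ_up / ε`. -/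
def Params.κUp (p : Params) : ℝ := p.ΓUp / p.ε

/-- The emergent generator `𝓛̃`. -/
def Params.generatorInf (p : Params) (X : BosOp) : BosOp :=
  Complex.I • (opMul p.hamiltonianInf X - opMul X p.hamiltonianInf)
    + ((p.γDown : ℂ) • dissipatorInf (spinInf lower) X
        + (p.γUp : ℂ) • dissipatorInf (spinInf raise) X)
    + ((p.κDown : ℂ) • dissipatorInf (bosInf a) X + (p.κUp : ℂ) • dissipatorInf (bosInf aᴴ) X)

/-- `P^μ = τ_{μ₁} (a†)^{μ₂} a^{μ₃} (-ε)^{μ₄}`. -/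
def Params.monInf (p : Params) (μ : MonIndex) : BosOp :=
  (((-p.ε) ^ μ.avg : ℝ) : ℂ) • (pauli μ.spin ⊗ₖ opMul (opPow aᴴ μ.cre) (opPow a μ.ann))

/-- The Boltzmann factor `e^{-βω} = Γ_up / (Γ₊ ε + Γ_up)`. It is `0` when `Γ_up = 0`, and the
thermal state is then the vacuum. -/
def Params.boltzmann (p : Params) : ℝ := p.ΓUp / (p.ΓPlus * p.ε + p.ΓUp)

/-- The thermal density matrix `ρ_β = (1 - e^{-βω}) e^{-βω a† a}`. -/
def Params.thermal (p : Params) : Matrix ℕ ℕ ℂ :=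
  Matrix.diagonal fun n => (((1 - p.boltzmann) * p.boltzmann ^ n : ℝ) : ℂ)

/-- The diagonal entries of `(ρ ⊗ ρ_β) X`; their sum is the expectation of `X`. -/
def Params.diagInf (p : Params) (ρ : Matrix (Fin 2) (Fin 2) ℂ) (X : BosOp) (i : Fin 2 × ℕ) : ℂ :=
  opMul (ρ ⊗ₖ p.thermal) X i i

/-- `φ ⊗ Ω̃_β (X) = Tr ((ρ ⊗ ρ_β) X)`, where `φ` is the state with density matrix `ρ`. -/
def Params.stateInf (p : Params) (ρ : Matrix (Fin 2) (Fin 2) ℂ) (X : BosOp) : ℂ :=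
  ∑' i, p.diagInf ρ X i

/-- `P^ν Y P^η`. -/
def Params.sandwichInf (p : Params) (ν η : MonIndex) (Y : BosOp) : BosOp :=
  opMul (opMul (p.monInf ν) Y) (p.monInf η)

/-- `φ ⊗ Ω̃_β (P^ν Y P^η)`. -/
def Params.corrInf (p : Params) (ρ : Matrix (Fin 2) (Fin 2) ℂ) (ν η : MonIndex)
    (Y : BosOp) : ℂ :=
  p.stateInf ρ (p.sandwichInf ν η Y)

/-! ### The two assumptions -/

/-- (A1): for every time `t ≥ 0`, the limit `N → ∞` may be exchanged with the power series of
`e^{t𝓛}`. It is not part of the assumption that the limits `c k` of the single terms exist. -/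
def Params.A1 (p : Params) (ρ : Matrix (Fin 2) (Fin 2) ℂ) (ν μ η : MonIndex) : Prop :=
  ∀ t : ℝ, 0 ≤ t → ∀ c : ℕ → ℂ,
    (∀ k, Tendsto (fun N : ℕ => p.corrN ρ N ν η ((p.generator N)^[k] (p.monN N μ)))
      atTop (𝓝 (c k))) →
    ∃ S : ℂ,
      Tendsto (fun n : ℕ => ∑ k ∈ Finset.range n, ((t ^ k / (k.factorial : ℝ) : ℝ) : ℂ) * c k)
        atTop (𝓝 S) ∧
      Tendsto (fun N : ℕ => p.corrN ρ N ν η (expSeries (p.generator N) t (p.monN N μ)))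
        atTop (𝓝 S)

/-- (A2): `e^{t𝓛̃}[P^μ]` and its correlation function with `P^ν` and `P^η` exist for every time
`t ≥ 0`, and the correlation function is the sum of the power series of the correlation functions
of `𝓛̃ᵏ[P^μ]`, uniformly for `t` in compact sets. -/
def Params.A2 (p : Params) (ρ : Matrix (Fin 2) (Fin 2) ℂ) (ν μ η : MonIndex) : Prop :=
  (∀ t : ℝ, 0 ≤ t →
    Summable (fun k : ℕ =>
      ((t ^ k / (k.factorial : ℝ) : ℝ) : ℂ) • (p.generatorInf^[k]) (p.monInf μ)) ∧
    Summable (p.diagInf ρ (p.sandwichInf ν η (expSeries p.generatorInf t (p.monInf μ))))) ∧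
  ∀ K : Set ℝ, K ⊆ Set.Ici 0 → IsCompact K →
    TendstoUniformlyOn
      (fun (n : ℕ) (t : ℝ) => ∑ k ∈ Finset.range n, ((t ^ k / (k.factorial : ℝ) : ℝ) : ℂ) *
        p.corrInf ρ ν η ((p.generatorInf^[k]) (p.monInf μ)))
      (fun t => p.corrInf ρ ν η (expSeries p.generatorInf t (p.monInf μ))) atTop K

end CentralSpin

end

/-! By (A1) it suffices to show, for each fixed `k`, that the correlation function of `𝓛ᵏ[P_N^μ]`
converges to that of `𝓛̃ᵏ[P^μ]`; (A2) then identifies the sum of these limits. Nothing else about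
the exponential is needed.

For fixed `k`, each sequence of finite-system operators is carried along with its candidate limit as
one `PairOp`, so that an algebraic identity is stated for both at once. The relevant pairs are
polynomials in letters: spin operators, `letH = (1/√N, 0)`, and the pairs `(a_N, a)`, `(a_N†, a†)`,
`(m_z^N, -ε)`. `Params.Filt` counts the letters of the last three kinds. The bath has `N + 1` spins
throughout, so that no normalization divides by zero. Two facts carry the proof.

The generators preserve these polynomials (`Params.Filt.genPair`). Only the bath dissipator, a sum
over sites, is not visibly polynomial in the letters. It is a derivation up to the site average of
products of local commutators scaled by `√N` (`Params.Admissible.bathDiss_mul`). Such a commutator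
replaces one letter by a one-spin operator, and site averages of one-spin operators are combinations
of `1`, `m_z`, `a_N/√N` and `a_N†/√N`. In the limit a bath spin becomes an additional spin commuting
with the mode, and the same product rule yields the rates `κ` of the emergent dissipator.

Expectations of polynomials converge (`Params.Filt.converges`), by induction on the number of
letters. The bath state and the thermal state satisfy the same KMS relation `⟨X a⟩ = b ⟨a X⟩`, with
`b = Γ_up/Γ_down < 1`. Hence `⟨a X⟩ = (1 - b)⁻¹ ⟨[a, X]⟩`, and commuting with `a` does not add
letters to `X`; `a†` is treated alike. A leading `m_z` may be replaced by `-ε` up to `O(1/√N)`.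
Without letters both expectations are `Tr(ρ A)`.

The unbounded limit operators are handled as endomorphisms of the vectors of finite particle number.
Their growth is polynomial (`Tame`), so the geometric weights of the thermal state make all
expectations absolutely convergent. -/

noncomputable section

namespace CentralSpin

/-! ### Product matrices and single-site operators of the bath -/

/-- The tensor product of one-spin matrices. -/
def piMat {N : ℕ} (M : Fin N → Matrix (Fin 2) (Fin 2) ℂ) : Matrix (Bath N) (Bath N) ℂ :=
  Matrix.of fun x y => ∏ j, M j (x j) (y j)

/-- The sum over intermediate configurations of a product over sites factors into one-site sums. -/
theorem piMat_mul {N : ℕ} (M M' : Fin N → Matrix (Fin 2) (Fin 2) ℂ) :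
    piMat M * piMat M' = piMat fun j => M j * M' j := by
  ext x y
  simp only [piMat, Matrix.mul_apply, Matrix.of_apply, ← Finset.prod_mul_distrib]
  rw [Finset.prod_univ_sum, Fintype.piFinset_univ]

theorem trace_piMat {N : ℕ} (M : Fin N → Matrix (Fin 2) (Fin 2) ℂ) :
    (piMat M).trace = ∏ j, (M j).trace := by
  simp only [piMat, Matrix.trace, Matrix.diag, Matrix.of_apply]
  rw [Finset.prod_univ_sum, Fintype.piFinset_univ]

theorem site_eq_piMat {N : ℕ} (k : Fin N) (A : Matrix (Fin 2) (Fin 2) ℂ) :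
    site k A = piMat (Function.update (fun _ => 1) k A) := by
  ext x y
  simp only [site, piMat, Matrix.of_apply]
  refine Finset.prod_congr rfl fun j _ => ?_
  by_cases h : j = k
  · subst h; simp
  · simp [h]

theorem piMat_one {N : ℕ} : piMat (fun _ : Fin N => 1) = 1 := by
  ext x y
  simp only [piMat, Matrix.of_apply, Matrix.one_apply, Finset.prod_ite_zero, Finset.prod_const_one]
  simp [funext_iff]

theorem piMat_update_add {N : ℕ} (M : Fin N → Matrix (Fin 2) (Fin 2) ℂ) (k : Fin N)
    (A B : Matrix (Fin 2) (Fin 2) ℂ) :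
    piMat (Function.update M k (A + B)) =
      piMat (Function.update M k A) + piMat (Function.update M k B) := by
  ext x y
  have h : ∀ C : Matrix (Fin 2) (Fin 2) ℂ, piMat (Function.update M k C) x y =
      C (x k) (y k) * ∏ j ∈ Finset.univ.erase k, M j (x j) (y j) := by
    intro C
    simp only [piMat, Matrix.of_apply]
    rw [← Finset.mul_prod_erase _ _ (Finset.mem_univ k), Function.update_self]
    congr 1
    refine Finset.prod_congr rfl fun j hj => ?_
    rw [Function.update_of_ne (Finset.ne_of_mem_erase hj)]
  rw [Matrix.add_apply, h, h, h, Matrix.add_apply, add_mul]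

theorem piMat_update_smul {N : ℕ} (M : Fin N → Matrix (Fin 2) (Fin 2) ℂ) (k : Fin N) (c : ℂ)
    (A : Matrix (Fin 2) (Fin 2) ℂ) :
    piMat (Function.update M k (c • A)) = c • piMat (Function.update M k A) := by
  ext x y
  have h : ∀ C : Matrix (Fin 2) (Fin 2) ℂ, piMat (Function.update M k C) x y =
      C (x k) (y k) * ∏ j ∈ Finset.univ.erase k, M j (x j) (y j) := by
    intro C
    simp only [piMat, Matrix.of_apply]
    rw [← Finset.mul_prod_erase _ _ (Finset.mem_univ k), Function.update_self]
    congr 1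
    refine Finset.prod_congr rfl fun j hj => ?_
    rw [Function.update_of_ne (Finset.ne_of_mem_erase hj)]
  rw [Matrix.smul_apply, h, h, Matrix.smul_apply, smul_mul_assoc]

theorem site_one {N : ℕ} (k : Fin N) : site k 1 = 1 := by
  rw [site_eq_piMat, ← piMat_one]
  congr 1
  exact Function.update_eq_self_iff.2 rfl

theorem site_mul {N : ℕ} (k : Fin N) (A B : Matrix (Fin 2) (Fin 2) ℂ) :
    site k A * site k B = site k (A * B) := by
  rw [site_eq_piMat, site_eq_piMat, site_eq_piMat, piMat_mul]
  congr 1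
  ext1 j
  by_cases h : j = k
  · subst h; simp
  · simp [h]

theorem site_comm {N : ℕ} {k l : Fin N} (hkl : k ≠ l) (A B : Matrix (Fin 2) (Fin 2) ℂ) :
    site k A * site l B = site l B * site k A := by
  rw [site_eq_piMat, site_eq_piMat, piMat_mul, piMat_mul]
  congr 1
  ext1 j
  by_cases h : j = k
  · subst h; simp [hkl]
  · simp [h]

theorem conjTranspose_site {N : ℕ} (k : Fin N) (A : Matrix (Fin 2) (Fin 2) ℂ) :
    (site k A)ᴴ = site k Aᴴ := by
  ext x y
  simp only [site, Matrix.conjTranspose_apply, Matrix.of_apply, star_prod]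
  refine Finset.prod_congr rfl fun j _ => ?_
  split_ifs
  · rfl
  · simp [Matrix.one_apply, eq_comm, apply_ite]

/-- The one-spin operator `A` at bath spin `k`, on the whole finite system. -/
def siteOp {N : ℕ} (k : Fin N) (A : Matrix (Fin 2) (Fin 2) ℂ) : FinOp N := onBath (site k A)

theorem onBath_mul {N : ℕ} (A B : Matrix (Bath N) (Bath N) ℂ) :
    onBath (A * B) = onBath A * onBath B := by
  simp [onBath, ← Matrix.mul_kronecker_mul]

theorem onSpin_mul {N : ℕ} (A B : Matrix (Fin 2) (Fin 2) ℂ) :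
    (onSpin (A * B) : FinOp N) = onSpin A * onSpin B := by
  simp [onSpin, ← Matrix.mul_kronecker_mul]

theorem onBath_one {N : ℕ} : (onBath 1 : FinOp N) = 1 := by simp [onBath]

theorem onSpin_one {N : ℕ} : (onSpin 1 : FinOp N) = 1 := by simp [onSpin]

theorem onBath_add {N : ℕ} (A B : Matrix (Bath N) (Bath N) ℂ) :
    onBath (A + B) = onBath A + onBath B := Matrix.kronecker_add _ _ _

theorem onBath_smul {N : ℕ} (c : ℂ) (A : Matrix (Bath N) (Bath N) ℂ) :
    onBath (c • A) = c • onBath A := Matrix.kronecker_smul _ _ _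

theorem onBath_sum {N : ℕ} {ι : Type*} (s : Finset ι) (A : ι → Matrix (Bath N) (Bath N) ℂ) :
    onBath (∑ k ∈ s, A k) = ∑ k ∈ s, onBath (A k) :=
  map_sum (AddMonoidHom.mk' onBath onBath_add) A s

theorem onBath_pow {N : ℕ} (A : Matrix (Bath N) (Bath N) ℂ) (n : ℕ) :
    onBath (A ^ n) = onBath A ^ n := by
  induction n with
  | zero => simp [onBath_one]
  | succ n ih => rw [pow_succ, onBath_mul, ih, pow_succ]

theorem onSpin_smul {N : ℕ} (c : ℂ) (A : Matrix (Fin 2) (Fin 2) ℂ) :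
    (onSpin (c • A) : FinOp N) = c • onSpin A := Matrix.smul_kronecker _ _ _

theorem onSpin_mul_onBath {N : ℕ} (A : Matrix (Fin 2) (Fin 2) ℂ) (B : Matrix (Bath N) (Bath N) ℂ) :
    onSpin A * onBath B = onBath B * onSpin A := by
  simp [onSpin, onBath, ← Matrix.mul_kronecker_mul]

theorem conjTranspose_onBath {N : ℕ} (A : Matrix (Bath N) (Bath N) ℂ) :
    (onBath A)ᴴ = onBath Aᴴ := by
  simp [onBath, Matrix.conjTranspose_kronecker]

theorem conjTranspose_onSpin {N : ℕ} (A : Matrix (Fin 2) (Fin 2) ℂ) :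
    (onSpin A : FinOp N)ᴴ = onSpin Aᴴ := by
  simp [onSpin, Matrix.conjTranspose_kronecker]

theorem siteOp_one {N : ℕ} (k : Fin N) : siteOp k 1 = 1 := by
  rw [siteOp, site_one, onBath_one]

theorem siteOp_mul {N : ℕ} (k : Fin N) (A B : Matrix (Fin 2) (Fin 2) ℂ) :
    siteOp k (A * B) = siteOp k A * siteOp k B := by
  rw [siteOp, ← site_mul, onBath_mul, siteOp, siteOp]

theorem siteOp_add {N : ℕ} (k : Fin N) (A B : Matrix (Fin 2) (Fin 2) ℂ) :
    siteOp k (A + B) = siteOp k A + siteOp k B := by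
  simp only [siteOp, ← onBath_add, site_eq_piMat, piMat_update_add]

theorem siteOp_smul {N : ℕ} (k : Fin N) (c : ℂ) (A : Matrix (Fin 2) (Fin 2) ℂ) :
    siteOp k (c • A) = c • siteOp k A := by
  simp only [siteOp, ← onBath_smul, site_eq_piMat, piMat_update_smul]

theorem siteOp_sub {N : ℕ} (k : Fin N) (A B : Matrix (Fin 2) (Fin 2) ℂ) :
    siteOp k (A - B) = siteOp k A - siteOp k B := by
  rw [sub_eq_add_neg, siteOp_add, ← neg_one_smul ℂ B, siteOp_smul, neg_one_smul, sub_eq_add_neg]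

theorem siteOp_comm {N : ℕ} {k l : Fin N} (hkl : k ≠ l) (A B : Matrix (Fin 2) (Fin 2) ℂ) :
    siteOp k A * siteOp l B = siteOp l B * siteOp k A := by
  rw [siteOp, siteOp, ← onBath_mul, site_comm hkl, onBath_mul]

theorem conjTranspose_siteOp {N : ℕ} (k : Fin N) (A : Matrix (Fin 2) (Fin 2) ℂ) :
    (siteOp k A)ᴴ = siteOp k Aᴴ := by
  rw [siteOp, conjTranspose_onBath, conjTranspose_site, siteOp]

theorem onBath_collective {N : ℕ} (A : Matrix (Fin 2) (Fin 2) ℂ) :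
    onBath (collective N A) = ∑ k, siteOp k A := onBath_sum _ _

/-- A single-site operator has a nontrivial commutator only with its own term of a collective
operator. -/
theorem siteOp_commutator_sum {N : ℕ} (k : Fin N) (A B : Matrix (Fin 2) (Fin 2) ℂ) :
    siteOp k A * (∑ l, siteOp l B) - (∑ l, siteOp l B) * siteOp k A =
      siteOp k (A * B - B * A) := by
  rw [Finset.mul_sum, Finset.sum_mul, ← Finset.sum_sub_distrib,
    Finset.sum_eq_single k, siteOp_sub, siteOp_mul, siteOp_mul]
  · intro l _ hl
    rw [siteOp_comm hl, sub_self]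
  · simp

theorem sum_siteOp_commutator {N : ℕ} (A B : Matrix (Fin 2) (Fin 2) ℂ) :
    (∑ k, siteOp k A) * (∑ l, siteOp l B) - (∑ l, siteOp l B) * (∑ k : Fin N, siteOp k A) =
      ∑ k, siteOp k (A * B - B * A) := by
  rw [Finset.sum_mul, Finset.mul_sum, ← Finset.sum_sub_distrib]
  exact Finset.sum_congr rfl fun k _ => siteOp_commutator_sum k A B

theorem onSpin_mul_siteOp {N : ℕ} (k : Fin N) (A B : Matrix (Fin 2) (Fin 2) ℂ) :
    onSpin A * siteOp k B = siteOp k B * onSpin A := onSpin_mul_onBath _ _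

/-! ### Relations of the Pauli matrices -/

theorem raise_eq : raise = !![0, 1; 0, 0] := by
  ext i j; fin_cases i <;> fin_cases j <;> simp [raise, lower]

theorem conjTranspose_raise : raiseᴴ = lower := by rw [raise, Matrix.conjTranspose_conjTranspose]

theorem pauli_three : pauli 3 = !![1, 0; 0, -1] := rfl

theorem raise_lower_commutator : raise * lower - lower * raise = pauli 3 := by
  rw [raise_eq, lower, pauli_three]; ext i j; fin_cases i <;> fin_cases j <;> simp

theorem lower_pauli_commutator : lower * pauli 3 - pauli 3 * lower = (2 : ℂ) • lower := by
  rw [lower, pauli_three]; ext i j; fin_cases i <;> fin_cases j <;> simp <;> norm_num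

theorem raise_pauli_commutator : raise * pauli 3 - pauli 3 * raise = (-2 : ℂ) • raise := by
  rw [raise_eq, pauli_three]; ext i j; fin_cases i <;> fin_cases j <;> simp <;> norm_num

theorem raise_mul_lower : raise * lower = (1 / 2 : ℂ) • (1 + pauli 3) := by
  rw [raise_eq, lower, pauli_three]; ext i j; fin_cases i <;> fin_cases j <;> simp <;> norm_num

theorem lower_mul_raise : lower * raise = (1 / 2 : ℂ) • (1 - pauli 3) := by
  rw [raise_eq, lower, pauli_three]; ext i j; fin_cases i <;> fin_cases j <;> simp <;> norm_num

/-- Every one-spin matrix is a combination of `1, σ_z, σ_-, σ_+`. -/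
theorem exists_pauli_combination (A : Matrix (Fin 2) (Fin 2) ℂ) :
    ∃ c d e f : ℂ, A = c • 1 + d • pauli 3 + e • lower + f • raise := by
  refine ⟨(A 0 0 + A 1 1) / 2, (A 0 0 - A 1 1) / 2, A 1 0, A 0 1, ?_⟩
  rw [raise_eq, lower, pauli_three]
  ext i j; fin_cases i <;> fin_cases j <;> simp <;> ring

/-! ### Parameters -/

theorem Params.trace_bathSpinState (p : Params) : p.bathSpinState.trace = 1 := by
  simp [Params.bathSpinState, Matrix.trace, pauli_three, Fin.sum_univ_two]
  ring

/-- The conditions on the rates of the bath. -/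
structure Params.Admissible (p : Params) : Prop where
  up_nonneg : 0 ≤ p.ΓUp
  up_lt_down : p.ΓUp < p.ΓDown

namespace Params.Admissible

variable {p : Params} (hp : p.Admissible)
include hp

theorem down_pos : 0 < p.ΓDown := hp.up_nonneg.trans_lt hp.up_lt_down

theorem plus_pos : 0 < p.ΓPlus := add_pos_of_nonneg_of_pos hp.up_nonneg hp.down_pos

theorem plus_mul_ε : p.ΓPlus * p.ε = p.ΓDown - p.ΓUp := by
  have := hp.plus_pos.ne'
  rw [Params.ε, Params.ΓMinus]; field_simp; ring

theorem ε_pos : 0 < p.ε := by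
  have h := hp.plus_mul_ε
  have h2 : 0 < p.ΓPlus * p.ε := by rw [h]; linarith [hp.up_lt_down]
  exact pos_of_mul_pos_right h2 hp.plus_pos.le

theorem boltzmann_eq : p.boltzmann = p.ΓUp / p.ΓDown := by
  rw [Params.boltzmann, hp.plus_mul_ε, sub_add_cancel]

theorem boltzmann_nonneg : 0 ≤ p.boltzmann := by
  rw [hp.boltzmann_eq]; exact div_nonneg hp.up_nonneg hp.down_pos.le

theorem boltzmann_lt_one : p.boltzmann < 1 := by
  rw [hp.boltzmann_eq, div_lt_one hp.down_pos]; exact hp.up_lt_down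

/-- The populations of a bath spin have the ratio `Γ_up : Γ_down`, which is also the ratio of
successive weights of the thermal state. This is why bath and mode obey KMS relations with the same
constant. -/
theorem bathSpinState_eq :
    p.bathSpinState = ((p.ΓDown / p.ΓPlus : ℝ) : ℂ) • !![(p.boltzmann : ℂ), 0; 0, 1] := by
  have h1 : p.ΓMinus / p.ΓPlus = 2 * (p.ΓDown / p.ΓPlus * p.boltzmann) - 1 := by
    have := hp.plus_pos.ne'
    have := hp.down_pos.ne'
    rw [hp.boltzmann_eq]; field_simp; rw [Params.ΓMinus, Params.ΓPlus]; ring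
  have h2 : p.ΓMinus / p.ΓPlus = 1 - 2 * (p.ΓDown / p.ΓPlus) := by
    have := hp.plus_pos.ne'
    field_simp; rw [Params.ΓMinus, Params.ΓPlus]; ring
  rw [Params.bathSpinState, pauli_three]
  ext i j; fin_cases i <;> fin_cases j
  · simp only [h1]; simp
  · simp
  · simp
  · simp only [h2]; simp

theorem lower_mul_bathSpinState :
    lower * p.bathSpinState = (p.boltzmann : ℂ) • (p.bathSpinState * lower) := by
  rw [hp.bathSpinState_eq, lower]
  ext i j; fin_cases i <;> fin_cases j <;> simp [mul_comm]

theorem bathSpinState_mul_raise :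
    p.bathSpinState * raise = (p.boltzmann : ℂ) • (raise * p.bathSpinState) := by
  rw [hp.bathSpinState_eq, raise_eq]
  ext i j; fin_cases i <;> fin_cases j <;> simp [mul_comm]

end Params.Admissible

/-! ### The stationary state of the bath -/

theorem Params.bathState_eq (p : Params) (N : ℕ) :
    p.bathState N = piMat fun _ => p.bathSpinState := rfl

theorem site_mul_piMat {N : ℕ} (k : Fin N) (A : Matrix (Fin 2) (Fin 2) ℂ)
    (M : Fin N → Matrix (Fin 2) (Fin 2) ℂ) :
    site k A * piMat M = piMat (Function.update M k (A * M k)) := by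
  rw [site_eq_piMat, piMat_mul]
  congr 1; ext1 j
  by_cases h : j = k
  · subst h; simp
  · simp [h]

theorem piMat_mul_site {N : ℕ} (k : Fin N) (A : Matrix (Fin 2) (Fin 2) ℂ)
    (M : Fin N → Matrix (Fin 2) (Fin 2) ℂ) :
    piMat M * site k A = piMat (Function.update M k (M k * A)) := by
  rw [site_eq_piMat, piMat_mul]
  congr 1; ext1 j
  by_cases h : j = k
  · subst h; simp
  · simp [h]

theorem Params.stateN_add (p : Params) (ρ : Matrix (Fin 2) (Fin 2) ℂ) (N : ℕ) (X Y : FinOp N) :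
    p.stateN ρ N (X + Y) = p.stateN ρ N X + p.stateN ρ N Y := by
  simp [Params.stateN, Matrix.mul_add]

theorem Params.stateN_smul (p : Params) (ρ : Matrix (Fin 2) (Fin 2) ℂ) (N : ℕ) (c : ℂ)
    (X : FinOp N) : p.stateN ρ N (c • X) = c * p.stateN ρ N X := by
  simp [Params.stateN]

theorem Params.stateN_sub (p : Params) (ρ : Matrix (Fin 2) (Fin 2) ℂ) (N : ℕ) (X Y : FinOp N) :
    p.stateN ρ N (X - Y) = p.stateN ρ N X - p.stateN ρ N Y := by
  simp [Params.stateN, Matrix.mul_sub]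

theorem Params.stateN_sum (p : Params) (ρ : Matrix (Fin 2) (Fin 2) ℂ) (N : ℕ) {ι : Type*}
    (s : Finset ι) (X : ι → FinOp N) :
    p.stateN ρ N (∑ k ∈ s, X k) = ∑ k ∈ s, p.stateN ρ N (X k) :=
  map_sum (AddMonoidHom.mk' (p.stateN ρ N) (p.stateN_add ρ N)) X s

namespace Params.Admissible

variable {p : Params} (hp : p.Admissible) (ρ : Matrix (Fin 2) (Fin 2) ℂ) {N : ℕ}
include hp

theorem stateN_onSpin (A : Matrix (Fin 2) (Fin 2) ℂ) :
    p.stateN ρ N (onSpin A) = (ρ * A).trace := by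
  rw [Params.stateN, onSpin, ← Matrix.mul_kronecker_mul, Matrix.trace_kronecker, Matrix.mul_one,
    Params.bathState_eq, trace_piMat]
  simp [p.trace_bathSpinState]

/-- The KMS relation of the lowering operator of one bath spin. -/
theorem stateN_mul_lower (k : Fin N) (X : FinOp N) :
    p.stateN ρ N (X * siteOp k lower) = p.boltzmann * p.stateN ρ N (siteOp k lower * X) := by
  have h : siteOp k lower * (ρ ⊗ₖ p.bathState N) =
      (p.boltzmann : ℂ) • ((ρ ⊗ₖ p.bathState N) * siteOp k lower) := by
    rw [siteOp, onBath, ← Matrix.mul_kronecker_mul, ← Matrix.mul_kronecker_mul,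
      Params.bathState_eq, site_mul_piMat, piMat_mul_site, hp.lower_mul_bathSpinState,
      piMat_update_smul, Matrix.kronecker_smul, Matrix.one_mul, Matrix.mul_one]
  rw [Params.stateN, Params.stateN, ← Matrix.mul_assoc, Matrix.trace_mul_comm, ← Matrix.mul_assoc,
    h, Matrix.smul_mul, Matrix.trace_smul, smul_eq_mul, Matrix.mul_assoc]

/-- The KMS relation of the raising operator of one bath spin. -/
theorem stateN_raise_mul (k : Fin N) (X : FinOp N) :
    p.stateN ρ N (siteOp k raise * X) = p.boltzmann * p.stateN ρ N (X * siteOp k raise) := by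
  have h : (ρ ⊗ₖ p.bathState N) * siteOp k raise =
      (p.boltzmann : ℂ) • (siteOp k raise * (ρ ⊗ₖ p.bathState N)) := by
    rw [siteOp, onBath, ← Matrix.mul_kronecker_mul, ← Matrix.mul_kronecker_mul,
      Params.bathState_eq, site_mul_piMat, piMat_mul_site, hp.bathSpinState_mul_raise,
      piMat_update_smul, Matrix.kronecker_smul, Matrix.one_mul, Matrix.mul_one]
  rw [Params.stateN, Params.stateN, ← Matrix.mul_assoc, h, Matrix.smul_mul, Matrix.trace_smul,
    smul_eq_mul, Matrix.mul_assoc, Matrix.trace_mul_comm, ← Matrix.mul_assoc]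

/-- `σ_z + ε` at one site has, up to commutators, expectation `0`. -/
theorem stateN_pauli_add (k : Fin N) (X : FinOp N) :
    p.stateN ρ N (siteOp k (pauli 3) * X) + p.ε * p.stateN ρ N X =
      2 * (p.ΓUp / p.ΓPlus : ℝ) *
        p.stateN ρ N (siteOp k lower * (X * siteOp k raise - siteOp k raise * X)) := by
  -- KMS relates `σ₊σ₋X` to `σ₋Xσ₊`, and the latter differs from `σ₋σ₊X` by a commutator. As `σ₊σ₋`
  -- and `σ₋σ₊` are `(1 ± σ_z)/2`, this is a linear equation for the expectation of `σ_z X`.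
  have h1 := hp.stateN_raise_mul ρ k (siteOp k lower * X)
  rw [← Matrix.mul_assoc, ← siteOp_mul, raise_mul_lower] at h1
  have h2 : p.stateN ρ N (siteOp k (lower * raise) * X) = p.stateN ρ N
      (siteOp k lower * (siteOp k raise * X)) := by rw [siteOp_mul, Matrix.mul_assoc]
  rw [lower_mul_raise] at h2
  rw [Matrix.mul_sub, Params.stateN_sub, ← h2, ← Matrix.mul_assoc]
  simp only [siteOp_smul, siteOp_add, siteOp_sub, siteOp_one, Matrix.smul_mul, Matrix.add_mul,
    Matrix.sub_mul, Matrix.one_mul, Params.stateN_add, Params.stateN_sub,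
    Params.stateN_smul] at h1 ⊢
  have hd : ((p.ΓUp : ℝ) : ℂ) = p.boltzmann * p.ΓDown := by
    rw [hp.boltzmann_eq]; push_cast; rw [div_mul_cancel₀]; exact_mod_cast hp.down_pos.ne'
  have hε : (p.ε : ℂ) = (p.ΓDown - p.ΓUp) / p.ΓPlus := by
    rw [eq_div_iff (by exact_mod_cast hp.plus_pos.ne'), mul_comm]; exact_mod_cast hp.plus_mul_ε
  have hP : (p.ΓPlus : ℂ) ≠ 0 := by exact_mod_cast hp.plus_pos.ne'
  have hPs : (p.ΓPlus : ℂ) = p.ΓUp + p.ΓDown := by rw [Params.ΓPlus]; push_cast; rfl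
  push_cast
  rw [hε]
  field_simp
  rw [hPs, hd]
  linear_combination (2 * (p.ΓDown : ℂ)) * h1

end Params.Admissible

/-! ### Column-finite matrices as endomorphisms -/

/-- The matrix of an endomorphism of the finitely supported vectors. -/
def toMat {n : Type*} : Module.End ℂ (n →₀ ℂ) →ₗ[ℂ] Matrix n n ℂ where
  toFun T := Matrix.of fun i j => T (Finsupp.single j 1) i
  map_add' _ _ := rfl
  map_smul' _ _ := rfl

theorem toMat_apply {n : Type*} (T : Module.End ℂ (n →₀ ℂ)) (i j : n) :
    toMat T i j = T (Finsupp.single j 1) i := rfl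

/-- The columns of `toMat T` are finitely supported, so the series in `opMul` is a finite sum.
Products of infinite matrices thereby become compositions, which are associative. -/
theorem opMul_toMat {n : Type*} (S T : Module.End ℂ (n →₀ ℂ)) :
    opMul (toMat S) (toMat T) = toMat (S * T) := by
  ext i j
  simp only [opMul, Matrix.of_apply, toMat_apply, Module.End.mul_apply]
  have h : ∀ v : n →₀ ℂ, S v i = ∑ k ∈ v.support, v k * S (Finsupp.single k 1) i := by
    intro v
    conv_lhs => rw [← Finsupp.sum_single v, Finsupp.sum, map_sum, Finsupp.finsetSum_apply]
    refine Finset.sum_congr rfl fun k _ => ?_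
    rw [← mul_one (v k), ← smul_eq_mul, ← Finsupp.smul_single, map_smul]
    simp
  rw [h, tsum_eq_sum (s := (T (Finsupp.single j 1)).support)]
  · exact Finset.sum_congr rfl fun k _ => mul_comm _ _
  · intro k hk
    rw [Finsupp.notMem_support_iff.1 hk, mul_zero]

/-- The vectors of finite particle number in the spin-boson system. -/
abbrev Fock : Type := Fin 2 × ℕ →₀ ℂ

/-- Operators of the spin-boson system on the vectors of finite particle number. -/
abbrev FockEnd : Type := Module.End ℂ Fock

/-- A spin operator. -/
def spinE (A : Matrix (Fin 2) (Fin 2) ℂ) : FockEnd :=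
  Finsupp.linearCombination ℂ fun i : Fin 2 × ℕ => ∑ s, A s i.1 • Finsupp.single (s, i.2) (1 : ℂ)

/-- The annihilation operator. -/
def annE : FockEnd :=
  Finsupp.linearCombination ℂ fun i : Fin 2 × ℕ =>
    -- At particle number `0` the truncated `i.2 - 1` is harmless, because the coefficient vanishes.
    ((√(i.2 : ℝ) : ℝ) : ℂ) • Finsupp.single (i.1, i.2 - 1) (1 : ℂ)

/-- The creation operator. -/
def creE : FockEnd :=
  Finsupp.linearCombination ℂ fun i : Fin 2 × ℕ =>
    ((√((i.2 + 1 : ℕ) : ℝ) : ℝ) : ℂ) • Finsupp.single (i.1, i.2 + 1) (1 : ℂ)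

theorem spinE_single (A : Matrix (Fin 2) (Fin 2) ℂ) (s : Fin 2) (n : ℕ) :
    spinE A (Finsupp.single (s, n) 1) = ∑ s', A s' s • Finsupp.single (s', n) (1 : ℂ) := by
  simp [spinE]

theorem annE_single (s : Fin 2) (n : ℕ) :
    annE (Finsupp.single (s, n) 1) = ((√(n : ℝ) : ℝ) : ℂ) • Finsupp.single (s, n - 1) (1 : ℂ) := by
  simp [annE]

theorem creE_single (s : Fin 2) (n : ℕ) :
    creE (Finsupp.single (s, n) 1) =
      ((√((n + 1 : ℕ) : ℝ) : ℝ) : ℂ) • Finsupp.single (s, n + 1) (1 : ℂ) := by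
  simp [creE]

theorem fockEnd_ext {S T : FockEnd}
    (h : ∀ s n, S (Finsupp.single (s, n) 1) = T (Finsupp.single (s, n) 1)) : S = T :=
  Finsupp.lhom_ext' fun i => LinearMap.ext_ring (h i.1 i.2)

theorem spinE_mul (A B : Matrix (Fin 2) (Fin 2) ℂ) : spinE (A * B) = spinE A * spinE B := by
  refine fockEnd_ext fun s n => ?_
  rw [Module.End.mul_apply, spinE_single, spinE_single, map_sum]
  simp only [map_smul, spinE_single, Matrix.mul_apply, Fin.sum_univ_two, smul_add, add_smul,
    smul_smul, mul_comm]
  abel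

theorem spinE_one : spinE 1 = 1 := by
  refine fockEnd_ext fun s n => ?_
  rw [spinE_single]
  simp [Matrix.one_apply]

theorem spinE_smul (c : ℂ) (A : Matrix (Fin 2) (Fin 2) ℂ) : spinE (c • A) = c • spinE A := by
  refine fockEnd_ext fun s n => ?_
  rw [LinearMap.smul_apply]
  simp only [spinE_single, Fin.sum_univ_two, Matrix.smul_apply, smul_add, smul_smul, smul_eq_mul]

theorem spinE_annE_comm (A : Matrix (Fin 2) (Fin 2) ℂ) : spinE A * annE = annE * spinE A := by
  refine fockEnd_ext fun s n => ?_
  simp only [Module.End.mul_apply, spinE_single, annE_single, map_smul,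
    Fin.sum_univ_two, smul_add, smul_smul, mul_comm, map_add]

theorem spinE_creE_comm (A : Matrix (Fin 2) (Fin 2) ℂ) : spinE A * creE = creE * spinE A := by
  refine fockEnd_ext fun s n => ?_
  simp only [Module.End.mul_apply, spinE_single, creE_single, map_smul,
    Fin.sum_univ_two, smul_add, smul_smul, mul_comm, map_add]

theorem annE_creE_commutator : annE * creE - creE * annE = 1 := by
  refine fockEnd_ext fun s n => ?_
  simp only [LinearMap.sub_apply, Module.End.mul_apply, annE_single, creE_single, map_smul,
    smul_smul, Module.End.one_apply]
  rcases n with _ | n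
  · simp
  · simp only [Nat.add_sub_cancel]
    rw [← sub_smul, ← Complex.ofReal_mul, ← Complex.ofReal_mul, Real.mul_self_sqrt (by positivity),
      Real.mul_self_sqrt (by positivity)]
    push_cast
    simp

theorem annE_apply (v : Fock) (s : Fin 2) (n : ℕ) :
    annE v (s, n) = ((√((n + 1 : ℕ) : ℝ) : ℝ) : ℂ) * v (s, n + 1) := by
  induction v using Finsupp.induction_linear with
  | zero => simp
  | add f g hf hg => rw [map_add, Finsupp.add_apply, hf, hg, Finsupp.add_apply]; ring
  | single i c =>
    obtain ⟨s', m⟩ := i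
    rw [← mul_one c, ← smul_eq_mul, ← Finsupp.smul_single, map_smul, annE_single]
    rcases m with _ | m
    · simp
    · by_cases h : s' = s ∧ m = n
      · obtain ⟨rfl, rfl⟩ := h
        simp [mul_comm]
      · have : ¬ ((s', m) = (s, n)) := by simpa using h
        simp [h]

theorem creE_apply_zero (v : Fock) (s : Fin 2) : creE v (s, 0) = 0 := by
  induction v using Finsupp.induction_linear with
  | zero => simp
  | add f g hf hg => rw [map_add, Finsupp.add_apply, hf, hg, add_zero]
  | single i c =>
    rw [← mul_one c, ← smul_eq_mul, ← Finsupp.smul_single, map_smul, creE_single]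
    simp

theorem creE_apply_succ (v : Fock) (s : Fin 2) (n : ℕ) :
    creE v (s, n + 1) = ((√((n + 1 : ℕ) : ℝ) : ℝ) : ℂ) * v (s, n) := by
  induction v using Finsupp.induction_linear with
  | zero => simp
  | add f g hf hg => rw [map_add, Finsupp.add_apply, hf, hg, Finsupp.add_apply]; ring
  | single i c =>
    obtain ⟨s', m⟩ := i
    rw [← mul_one c, ← smul_eq_mul, ← Finsupp.smul_single, map_smul, creE_single]
    by_cases h : s' = s ∧ m = n
    · obtain ⟨rfl, rfl⟩ := h
      simp [mul_comm]
    · simp [h]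

/-! ### Matrices of the operators of the spin-boson system -/

theorem toMat_one {n : Type*} [DecidableEq n] : toMat (1 : Module.End ℂ (n →₀ ℂ)) = 1 := by
  ext i j
  simp [toMat_apply, Finsupp.single_apply, Matrix.one_apply, eq_comm]

theorem opPow_toMat {n : Type*} [DecidableEq n] (T : Module.End ℂ (n →₀ ℂ)) (k : ℕ) :
    opPow (toMat T) k = toMat (T ^ k) := by
  induction k with
  | zero => simp [opPow, toMat_one]
  | succ k ih =>
    rw [opPow] at ih ⊢
    rw [Function.iterate_succ_apply', ih, opMul_toMat, pow_succ']

theorem toMat_spinE (A : Matrix (Fin 2) (Fin 2) ℂ) : toMat (spinE A) = spinInf A := by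
  ext ⟨s, n⟩ ⟨s', n'⟩
  rw [toMat_apply, spinE_single]
  fin_cases s <;> simp [spinInf, Finsupp.single_apply, Matrix.one_apply, eq_comm]

theorem toMat_annE : toMat annE = bosInf a := by
  ext ⟨s, n⟩ ⟨s', n'⟩
  rw [toMat_apply, annE_apply]
  simp only [bosInf, a, Matrix.kroneckerMap_apply, Matrix.of_apply, Finsupp.single_apply,
    Matrix.one_apply, Prod.mk.injEq]
  by_cases h1 : s = s' <;> by_cases h2 : n' = n + 1 <;> simp [h1, h2, eq_comm]

theorem toMat_creE : toMat creE = bosInf aᴴ := by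
  ext ⟨s, n⟩ ⟨s', n'⟩
  simp only [bosInf, a, Matrix.kroneckerMap_apply, Matrix.of_apply, Matrix.conjTranspose_apply,
    Matrix.one_apply]
  rw [toMat_apply]
  rcases n with _ | n
  · rw [creE_apply_zero]; simp
  · rw [creE_apply_succ]
    simp only [Finsupp.single_apply, Prod.mk.injEq]
    simp only [eq_comm (a := s'), eq_comm (a := n')]
    by_cases h1 : s = s' <;> by_cases h2 : n = n' <;> simp [h1, h2]

theorem opMul_bosInf (B C : Matrix ℕ ℕ ℂ) : opMul (bosInf B) (bosInf C) = bosInf (opMul B C) := by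
  ext ⟨s, n⟩ ⟨s', n'⟩
  simp only [opMul, bosInf, Matrix.of_apply, Matrix.kroneckerMap_apply]
  have hinj : Function.Injective (fun k : ℕ => (s, k)) := fun _ _ h => (Prod.mk.inj h).2
  -- The identity on the spin confines the summation to the intermediate indices with spin `s`.
  rw [← hinj.tsum_eq]
  · simp only [Matrix.one_apply_eq, one_mul, mul_left_comm _ ((1 : Matrix (Fin 2) (Fin 2) ℂ) s s')]
    exact tsum_mul_left
  · rintro ⟨u, k⟩ hk
    by_cases h : s = u
    · exact ⟨k, by rw [h]⟩
    · simp [h] at hk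

theorem opPow_bosInf (B : Matrix ℕ ℕ ℂ) (k : ℕ) : opPow (bosInf B) k = bosInf (opPow B k) := by
  induction k with
  | zero => simp [opPow, bosInf]
  | succ k ih =>
    rw [opPow] at ih ⊢
    rw [Function.iterate_succ_apply', ih, opMul_bosInf, opPow, opPow,
      Function.iterate_succ_apply']

theorem opMul_spinInf_bosInf (A : Matrix (Fin 2) (Fin 2) ℂ) (B : Matrix ℕ ℕ ℂ) :
    opMul (spinInf A) (bosInf B) = A ⊗ₖ B := by
  ext ⟨s, n⟩ ⟨s', n'⟩
  simp only [opMul, bosInf, spinInf, Matrix.of_apply, Matrix.kroneckerMap_apply]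
  rw [tsum_eq_single (s', n)]
  · simp
  · rintro ⟨u, k⟩ hk
    by_cases h : n = k
    · subst h
      have : u ≠ s' := by simpa using hk
      simp [this]
    · simp [h]

theorem conjTranspose_spinInf (A : Matrix (Fin 2) (Fin 2) ℂ) : (spinInf A)ᴴ = spinInf Aᴴ := by
  simp [spinInf, Matrix.conjTranspose_kronecker]

theorem conjTranspose_bosInf (B : Matrix ℕ ℕ ℂ) : (bosInf B)ᴴ = bosInf Bᴴ := by
  simp [bosInf, Matrix.conjTranspose_kronecker]

/-! ### Operators of polynomial growth -/

/-- The norm `∑ ‖v_i‖ (n_i + 1)^e` of a vector of finite particle number. -/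
def wnorm (e : ℕ) (v : Fock) : ℝ := v.sum fun i z => ‖z‖ * ((i.2 : ℝ) + 1) ^ e

theorem wnorm_eq_sum (e : ℕ) (v : Fock) {s : Finset (Fin 2 × ℕ)} (h : v.support ⊆ s) :
    wnorm e v = ∑ i ∈ s, ‖v i‖ * ((i.2 : ℝ) + 1) ^ e :=
  Finsupp.sum_of_support_subset v h _ fun _ _ => by simp

theorem wnorm_single (e : ℕ) (i : Fin 2 × ℕ) (z : ℂ) :
    wnorm e (Finsupp.single i z) = ‖z‖ * ((i.2 : ℝ) + 1) ^ e := by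
  rw [wnorm, Finsupp.sum_single_index]; simp

theorem wnorm_add_le (e : ℕ) (v w : Fock) : wnorm e (v + w) ≤ wnorm e v + wnorm e w := by
  classical
  rw [wnorm_eq_sum e (v + w) Finsupp.support_add,
    wnorm_eq_sum e v (Finset.subset_union_left (s₂ := w.support)),
    wnorm_eq_sum e w (Finset.subset_union_right (s₁ := v.support)), ← Finset.sum_add_distrib]
  refine Finset.sum_le_sum fun i _ => ?_
  rw [← add_mul, Finsupp.add_apply]
  gcongr
  exact norm_add_le _ _

theorem wnorm_smul (e : ℕ) (c : ℂ) (v : Fock) : wnorm e (c • v) = ‖c‖ * wnorm e v := by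
  rw [wnorm_eq_sum e (c • v) Finsupp.support_smul, wnorm_eq_sum e v le_rfl, Finset.mul_sum]
  refine Finset.sum_congr rfl fun i _ => ?_
  rw [Finsupp.smul_apply, norm_smul, mul_assoc]

theorem wnorm_nonneg (e : ℕ) (v : Fock) : 0 ≤ wnorm e v :=
  Finset.sum_nonneg fun _ _ => by positivity

theorem wnorm_mono {d e : ℕ} (h : d ≤ e) (v : Fock) : wnorm d v ≤ wnorm e v := by
  refine Finset.sum_le_sum fun i _ => ?_
  simp only
  gcongr
  linarith [(Nat.cast_nonneg i.2 : (0 : ℝ) ≤ i.2)]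

theorem norm_apply_le_wnorm (v : Fock) (i : Fin 2 × ℕ) : ‖v i‖ ≤ wnorm 0 v := by
  by_cases h : i ∈ v.support
  · have := Finset.single_le_sum (f := fun i => ‖v i‖ * ((i.2 : ℝ) + 1) ^ 0)
      (fun _ _ => by positivity) h
    simpa [wnorm, Finsupp.sum] using this
  · rw [Finsupp.notMem_support_iff.1 h, norm_zero]; exact wnorm_nonneg _ _

/-- The operators that are bounded for the family of norms `wnorm`. -/
def Tame (T : FockEnd) : Prop :=
  ∀ e : ℕ, ∃ (C : ℝ) (d : ℕ), 0 ≤ C ∧ ∀ v, wnorm e (T v) ≤ C * wnorm d v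

/-- A weighted `ℓ¹` norm is additive over disjoint supports, so a bound on basis vectors extends to
all vectors with the same constant. -/
theorem Tame.of_single {T : FockEnd} (h : ∀ e : ℕ, ∃ (C : ℝ) (d : ℕ), 0 ≤ C ∧
    ∀ i : Fin 2 × ℕ, wnorm e (T (Finsupp.single i 1)) ≤ C * ((i.2 : ℝ) + 1) ^ d) : Tame T := by
  intro e
  obtain ⟨C, d, hC, h⟩ := h e
  refine ⟨C, d, hC, fun v => ?_⟩
  induction v using Finsupp.induction with
  | zero => simp [wnorm]
  | single_add i z f hi _ ih =>
    have h1 : wnorm d (Finsupp.single i z + f) = wnorm d (Finsupp.single i z) + wnorm d f := by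
      classical
      refine Finsupp.sum_add_index_of_disjoint ?_ _
      refine Finset.disjoint_of_subset_left Finsupp.support_single_subset ?_
      simpa using hi
    rw [h1, map_add, mul_add]
    refine (wnorm_add_le _ _ _).trans (add_le_add ?_ ih)
    rw [← mul_one z, ← smul_eq_mul, ← Finsupp.smul_single, map_smul, wnorm_smul, wnorm_smul,
      wnorm_single, norm_one, one_mul]
    calc ‖z‖ * wnorm e (T (Finsupp.single i 1)) ≤ ‖z‖ * (C * ((i.2 : ℝ) + 1) ^ d) := by
          gcongr; exact h i
      _ = _ := by ring

theorem Tame.add {S T : FockEnd} (hS : Tame S) (hT : Tame T) : Tame (S + T) := by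
  intro e
  obtain ⟨C, d, hC, h⟩ := hS e
  obtain ⟨C', d', hC', h'⟩ := hT e
  refine ⟨C + C', max d d', by positivity, fun v => ?_⟩
  rw [LinearMap.add_apply, add_mul]
  refine (wnorm_add_le _ _ _).trans (add_le_add ((h v).trans ?_) ((h' v).trans ?_))
  · gcongr; exact wnorm_mono (le_max_left _ _) v
  · gcongr; exact wnorm_mono (le_max_right _ _) v

/-- Composition needs a bound for every target weight: the weight that `S` requires is the one for
which `T` is then estimated. -/
theorem Tame.mul {S T : FockEnd} (hS : Tame S) (hT : Tame T) : Tame (S * T) := by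
  intro e
  obtain ⟨C, d, hC, h⟩ := hS e
  obtain ⟨C', d', hC', h'⟩ := hT d
  refine ⟨C * C', d', by positivity, fun v => ?_⟩
  rw [Module.End.mul_apply, mul_assoc]
  refine (h _).trans ?_
  gcongr
  exact h' v

theorem Tame.smul {T : FockEnd} (c : ℂ) (hT : Tame T) : Tame (c • T) := by
  intro e
  obtain ⟨C, d, hC, h⟩ := hT e
  refine ⟨‖c‖ * C, d, by positivity, fun v => ?_⟩
  rw [LinearMap.smul_apply, wnorm_smul, mul_assoc]
  gcongr
  exact h v

theorem fockEnd_sub_eq (S T : FockEnd) : S - T = S + (-1 : ℂ) • T :=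
  (sub_eq_add_neg S T).trans (congrArg (S + ·) (neg_one_smul ℂ T).symm)

theorem tame_spinE (A : Matrix (Fin 2) (Fin 2) ℂ) : Tame (spinE A) := by
  refine Tame.of_single fun e => ⟨∑ s, ∑ s', ‖A s s'‖, e, by positivity, ?_⟩
  rintro ⟨s, n⟩
  rw [spinE_single, Fin.sum_univ_two]
  refine (wnorm_add_le _ _ _).trans ?_
  simp only [wnorm_smul, wnorm_single, norm_one, one_mul, ← add_mul]
  gcongr
  simp only [Fin.sum_univ_two]
  fin_cases s
  · have h1 := norm_nonneg (A 0 1)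
    have h2 := norm_nonneg (A 1 1)
    simp; linarith
  · have h1 := norm_nonneg (A 0 0)
    have h2 := norm_nonneg (A 1 0)
    simp; linarith

theorem tame_annE : Tame annE := by
  refine Tame.of_single fun e => ⟨1, e + 1, zero_le_one, ?_⟩
  rintro ⟨s, n⟩
  have h0 : (0 : ℝ) ≤ n := Nat.cast_nonneg n
  rw [annE_single, wnorm_smul, wnorm_single, norm_one, one_mul, one_mul, pow_succ', Complex.norm_real,
    Real.norm_of_nonneg (Real.sqrt_nonneg _)]
  refine mul_le_mul ?_ ?_ (by positivity) (by positivity)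
  · exact Real.sqrt_le_iff.2 ⟨by positivity, by nlinarith⟩
  · gcongr; exact Nat.sub_le _ _

theorem tame_creE : Tame creE := by
  -- The shift of the particle number costs `(n + 2)^e ≤ 2^e (n + 1)^e`; the additional power
  -- absorbs `√(n + 1)`.
  refine Tame.of_single fun e => ⟨2 ^ e, e + 1, by positivity, ?_⟩
  rintro ⟨s, n⟩
  have h0 : (0 : ℝ) ≤ n := Nat.cast_nonneg n
  rw [creE_single, wnorm_smul, wnorm_single, norm_one, one_mul, pow_succ', Complex.norm_real,
    Real.norm_of_nonneg (Real.sqrt_nonneg _), mul_left_comm, ← mul_pow]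
  refine mul_le_mul ?_ ?_ (by positivity) (by positivity)
  · refine Real.sqrt_le_iff.2 ⟨by positivity, ?_⟩
    push_cast; nlinarith
  · push_cast; gcongr; linarith

theorem Tame.entry_bound {T : FockEnd} (hT : Tame T) :
    ∃ (C : ℝ) (d : ℕ), 0 ≤ C ∧ ∀ i j, ‖toMat T i j‖ ≤ C * ((j.2 : ℝ) + 1) ^ d := by
  obtain ⟨C, d, hC, h⟩ := hT 0
  refine ⟨C, d, hC, fun i j => (norm_apply_le_wnorm _ i).trans ((h _).trans ?_)⟩
  rw [wnorm_single, norm_one, one_mul]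

/-! ### The thermal state -/

theorem Params.diagInf_apply (p : Params) (ρ : Matrix (Fin 2) (Fin 2) ℂ) (X : BosOp) (s : Fin 2)
    (n : ℕ) : p.diagInf ρ X (s, n) =
      (((1 - p.boltzmann) * p.boltzmann ^ n : ℝ) : ℂ) * ∑ s', ρ s s' * X (s', n) (s, n) := by
  rw [Params.diagInf, opMul, Matrix.of_apply, tsum_eq_sum (s := Finset.univ ×ˢ {n}),
    Finset.sum_product, Finset.mul_sum]
  · refine Finset.sum_congr rfl fun s' _ => ?_
    rw [Finset.sum_singleton, Matrix.kroneckerMap_apply, Params.thermal, Matrix.diagonal_apply_eq]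
    ring
  · rintro ⟨s', k⟩ hk
    have : n ≠ k := by simpa [eq_comm] using hk
    rw [Matrix.kroneckerMap_apply, Params.thermal, Matrix.diagonal_apply_ne _ this]
    simp

namespace Params.Admissible

variable {p : Params} (hp : p.Admissible) (ρ : Matrix (Fin 2) (Fin 2) ℂ)
include hp

/-- Matrix elements grow at most polynomially in the particle number, while the thermal weights
decay geometrically since `b < 1`. -/
theorem summable_diagInf {T : FockEnd} (hT : Tame T) : Summable (p.diagInf ρ (toMat T)) := by
  obtain ⟨C, d, hC, h⟩ := hT.entry_bound
  have hb0 := hp.boltzmann_nonneg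
  have hb1 := hp.boltzmann_lt_one
  set b := p.boltzmann
  have hb : ‖b‖ < 1 := by rwa [Real.norm_of_nonneg hb0]
  -- This majorant comes from `(n + 1)^d ≤ 2^d (n^d + 1)`, which leaves two standard series.
  have hs : Summable fun n : ℕ => (2 : ℝ) ^ d * ((n : ℝ) ^ d * b ^ n + b ^ n) :=
    (((summable_pow_mul_geometric_of_norm_lt_one d hb).add
      (summable_geometric_of_lt_one hb0 hb1))).mul_left _
  have hs1 : Summable fun s : Fin 2 => (1 - b) * ((∑ s', ‖ρ s s'‖) * C) :=
    (hasSum_fintype _).summable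
  have hs2 := hs1.mul_of_nonneg hs (fun s => mul_nonneg (by linarith) (by positivity)) (fun n => by positivity)
  refine Summable.of_norm_bounded hs2 ?_
  rintro ⟨s, n⟩
  rw [Params.diagInf_apply, norm_mul, Complex.norm_real,
    Real.norm_of_nonneg (mul_nonneg (by linarith) (by positivity))]
  have h1 : ‖∑ s', ρ s s' * toMat T (s', n) (s, n)‖ ≤
      ((∑ s', ‖ρ s s'‖) * C) * ((n : ℝ) + 1) ^ d := by
    refine (norm_sum_le _ _).trans ?_
    rw [Finset.sum_mul, Finset.sum_mul]
    refine Finset.sum_le_sum fun s' _ => ?_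
    rw [norm_mul, mul_assoc]
    gcongr
    exact h _ _
  have h2 : ((n : ℝ) + 1) ^ d ≤ 2 ^ d * ((n : ℝ) ^ d + 1) := by
    rcases Nat.eq_zero_or_pos n with rfl | hn
    · have : (1 : ℝ) ≤ 2 ^ d := one_le_pow₀ (by norm_num)
      have h0 : (0 : ℝ) ≤ (0 : ℝ) ^ d := by positivity
      simp only [Nat.cast_zero, zero_add, one_pow]
      nlinarith
    · have hn' : (1 : ℝ) ≤ n := by exact_mod_cast hn
      calc ((n : ℝ) + 1) ^ d ≤ (2 * n) ^ d := by gcongr; linarith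
        _ = 2 ^ d * (n : ℝ) ^ d := mul_pow _ _ _
        _ ≤ _ := by gcongr; linarith
  have hb' : 0 ≤ 1 - b := by linarith
  calc (1 - b) * b ^ n * ‖∑ s', ρ s s' * toMat T (s', n) (s, n)‖
      ≤ (1 - b) * b ^ n * (((∑ s', ‖ρ s s'‖) * C) * (2 ^ d * ((n : ℝ) ^ d + 1))) := by
        refine mul_le_mul_of_nonneg_left (h1.trans ?_) (by positivity)
        gcongr
    _ = _ := by simp only; ring

theorem stateInf_add {S T : FockEnd} (hS : Tame S) (hT : Tame T) :
    p.stateInf ρ (toMat (S + T)) = p.stateInf ρ (toMat S) + p.stateInf ρ (toMat T) := by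
  rw [Params.stateInf, Params.stateInf, Params.stateInf,
    ← (hp.summable_diagInf ρ hS).tsum_add (hp.summable_diagInf ρ hT)]
  refine tsum_congr fun ⟨s, n⟩ => ?_
  simp only [Params.diagInf_apply, map_add, Matrix.add_apply, mul_add, Finset.sum_add_distrib]

omit hp in
theorem stateInf_smul (c : ℂ) (T : FockEnd) :
    p.stateInf ρ (toMat (c • T)) = c * p.stateInf ρ (toMat T) := by
  rw [Params.stateInf, Params.stateInf, ← tsum_mul_left]
  refine tsum_congr fun ⟨s, n⟩ => ?_
  simp only [Params.diagInf_apply, map_smul, Matrix.smul_apply, smul_eq_mul, Fin.sum_univ_two]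
  ring

theorem stateInf_sub {S T : FockEnd} (hS : Tame S) (hT : Tame T) :
    p.stateInf ρ (toMat (S - T)) = p.stateInf ρ (toMat S) - p.stateInf ρ (toMat T) := by
  rw [fockEnd_sub_eq, hp.stateInf_add ρ hS (hT.smul _), stateInf_smul,
    neg_one_mul, sub_eq_add_neg]

theorem stateInf_spinE (A : Matrix (Fin 2) (Fin 2) ℂ) :
    p.stateInf ρ (toMat (spinE A)) = (ρ * A).trace := by
  rw [Params.stateInf, (hp.summable_diagInf ρ (tame_spinE A)).tsum_prod, Matrix.trace, tsum_fintype]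
  refine Finset.sum_congr rfl fun s _ => ?_
  have h : ∀ n, p.diagInf ρ (toMat (spinE A)) (s, n) =
      ((1 - p.boltzmann : ℝ) : ℂ) * (ρ * A) s s * (p.boltzmann : ℂ) ^ n := by
    intro n
    simp only [Params.diagInf_apply, toMat_spinE, spinInf, Matrix.kroneckerMap_apply,
      Matrix.one_apply_eq, mul_one, Matrix.mul_apply]
    push_cast; ring
  simp only [h, Matrix.diag_apply]
  have hb1 : ‖(p.boltzmann : ℂ)‖ < 1 := by
    rw [Complex.norm_real, Real.norm_of_nonneg hp.boltzmann_nonneg]; exact hp.boltzmann_lt_one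
  rw [tsum_mul_left, tsum_geometric_of_norm_lt_one hb1]
  have : (1 : ℂ) - p.boltzmann ≠ 0 := by
    exact_mod_cast (sub_pos.2 hp.boltzmann_lt_one).ne'
  push_cast
  field_simp

/-- The KMS relation of the annihilation operator. -/
theorem stateInf_mul_annE {T : FockEnd} (hT : Tame T) :
    p.stateInf ρ (toMat (T * annE)) = p.boltzmann * p.stateInf ρ (toMat (annE * T)) := by
  have h1 := hp.summable_diagInf ρ (hT.mul tame_annE)
  have h2 := hp.summable_diagInf ρ (tame_annE.mul hT)
  rw [Params.stateInf, Params.stateInf, h1.tsum_prod, h2.tsum_prod, tsum_fintype, tsum_fintype,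
    Finset.mul_sum]
  refine Finset.sum_congr rfl fun s _ => ?_
  -- Since `a` kills the vacuum, the term `n = 0` of `T a` vanishes; after a shift, term `n + 1` of
  -- `T a` is `b` times term `n` of `a T`.
  rw [(h1.prod_factor s).tsum_eq_zero_add, ← tsum_mul_left]
  have h0 : p.diagInf ρ (toMat (T * annE)) (s, 0) = 0 := by
    simp [Params.diagInf_apply, toMat_apply, annE_single]
  rw [h0, zero_add]
  refine tsum_congr fun n => ?_
  simp only [Params.diagInf_apply, toMat_apply, Module.End.mul_apply, annE_single, annE_apply,
    map_smul, Finsupp.smul_apply, smul_eq_mul, Fin.sum_univ_two, Nat.add_sub_cancel, pow_succ]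
  push_cast
  ring

/-- The KMS relation of the creation operator. -/
theorem stateInf_creE_mul {T : FockEnd} (hT : Tame T) :
    p.stateInf ρ (toMat (creE * T)) = p.boltzmann * p.stateInf ρ (toMat (T * creE)) := by
  have h1 := hp.summable_diagInf ρ (tame_creE.mul hT)
  have h2 := hp.summable_diagInf ρ (hT.mul tame_creE)
  rw [Params.stateInf, Params.stateInf, h1.tsum_prod, h2.tsum_prod, tsum_fintype, tsum_fintype,
    Finset.mul_sum]
  refine Finset.sum_congr rfl fun s _ => ?_
  -- Here the term `n = 0` vanishes because no vector in the range of `a†` has a vacuum component.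
  rw [(h1.prod_factor s).tsum_eq_zero_add, ← tsum_mul_left]
  have h0 : p.diagInf ρ (toMat (creE * T)) (s, 0) = 0 := by
    simp [Params.diagInf_apply, toMat_apply, creE_apply_zero]
  rw [h0, zero_add]
  refine tsum_congr fun n => ?_
  simp only [Params.diagInf_apply, toMat_apply, Module.End.mul_apply, creE_single,
    creE_apply_succ, map_smul, Finsupp.smul_apply, smul_eq_mul, Fin.sum_univ_two, pow_succ]
  push_cast
  ring

end Params.Admissible

/-! ### Lindblad dissipators in an algebra -/

section Algebra

variable {R : Type*} [Ring R] [Algebra ℂ R]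

/-- `W X V - (W V X + X W V) / 2`; the dissipator of `V` if `W` is the adjoint of `V`. -/
def lindblad (V W X : R) : R := W * X * V - (1 / 2 : ℂ) • (W * V * X + X * (W * V))

/-- The defect in the Leibniz rule is a product of two commutators, one with each factor. For bath
spins each of these is local, and this makes the dissipator computable on polynomials. -/
theorem lindblad_mul (V W X Y : R) :
    lindblad V W (X * Y) = lindblad V W X * Y + X * lindblad V W Y +
      (W * X - X * W) * (Y * V - V * Y) := by
  simp only [lindblad, mul_sub, sub_mul, mul_add, add_mul, smul_mul_assoc, mul_smul_comm,
    mul_assoc, smul_add]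
  module

theorem lindblad_add (V W X Y : R) :
    lindblad V W (X + Y) = lindblad V W X + lindblad V W Y := by
  simp only [lindblad, mul_add, add_mul, smul_add]
  module

theorem lindblad_of_commute {V W X : R} (hV : V * X = X * V) (hW : W * X = X * W) :
    lindblad V W X = 0 := by
  have h : W * V * X = X * (W * V) := by rw [mul_assoc, hV, ← mul_assoc, hW, mul_assoc]
  rw [lindblad, h, hW, mul_assoc]
  module

/-- In this form a dissipator at one site visibly sees only the part of `X` that does not commute
with that site. -/
theorem lindblad_eq_commutators (V W X : R) :
    lindblad V W X = (1 / 2 : ℂ) • (W * (X * V - V * X) + (W * X - X * W) * V) := by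
  simp only [lindblad, mul_sub, sub_mul, mul_assoc, smul_add, smul_sub]
  module

end Algebra

theorem ringHom_commutator_add {R S : Type*} [Ring R] [Ring S] (f : R →+* S) (c d X Y : R) (B D : S) :
    f ((X + Y) * c - c * (X + Y)) * B + f (d * (X + Y) - (X + Y) * d) * D =
      (f (X * c - c * X) * B + f (d * X - X * d) * D) +
        (f (Y * c - c * Y) * B + f (d * Y - Y * d) * D) := by
  simp only [map_sub, map_add, map_mul, mul_add, add_mul, sub_mul]
  abel

/-- Abstract Leibniz rule for the limit component of `Params.locComm`: `f` embeds the mode operators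
as scalar matrices, and `B`, `D` are matrices of the additional spin. -/
theorem ringHom_commutator_mul {R S : Type*} [Ring R] [Ring S] (f : R →+* S) (c d X Y : R) {B D : S}
    (hB : B * f Y = f Y * B) (hD : D * f Y = f Y * D) :
    f ((X * Y) * c - c * (X * Y)) * B + f (d * (X * Y) - (X * Y) * d) * D =
      (f (X * c - c * X) * B + f (d * X - X * d) * D) * f Y +
        f X * (f (Y * c - c * Y) * B + f (d * Y - Y * d) * D) := by
  rw [add_mul, mul_assoc _ B, hB, mul_assoc _ D, hD]
  simp only [map_sub, map_mul, sub_mul, mul_sub, mul_add, mul_assoc]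
  abel

theorem dissipator_eq {n : Type*} [Fintype n] [DecidableEq n] (V X : Matrix n n ℂ) :
    dissipator V X = lindblad V Vᴴ X := rfl

theorem dissipatorInf_toMat {n : Type*} {V W : Module.End ℂ (n →₀ ℂ)}
    (h : (toMat V)ᴴ = toMat W) (X : Module.End ℂ (n →₀ ℂ)) :
    dissipatorInf (toMat V) (toMat X) = toMat (lindblad V W X) := by
  simp only [dissipatorInf, h, opMul_toMat, lindblad, map_sub, map_smul, map_add]

/-! ### The algebra of the spin-boson system -/

/-- The algebra of operators of the spin-boson system on the vectors of finite particle number. -/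
def FockOp : Type := FockEnd

instance : Ring FockOp := inferInstanceAs (Ring (Module.End ℂ Fock))

instance : Algebra ℂ FockOp := inferInstanceAs (Algebra ℂ (Module.End ℂ Fock))

/-- A spin operator, as an element of the algebra. -/
def opS (A : Matrix (Fin 2) (Fin 2) ℂ) : FockOp := spinE A

/-- The annihilation operator, as an element of the algebra. -/
def opA : FockOp := annE

/-- The creation operator, as an element of the algebra. -/
def opC : FockOp := creE

theorem opS_mul (A B : Matrix (Fin 2) (Fin 2) ℂ) : opS (A * B) = opS A * opS B := spinE_mul A B

theorem opS_one : opS 1 = 1 := spinE_one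

theorem opS_smul (c : ℂ) (A : Matrix (Fin 2) (Fin 2) ℂ) : opS (c • A) = c • opS A :=
  spinE_smul c A

theorem opS_opA_comm (A : Matrix (Fin 2) (Fin 2) ℂ) : opS A * opA = opA * opS A :=
  spinE_annE_comm A

theorem opS_opC_comm (A : Matrix (Fin 2) (Fin 2) ℂ) : opS A * opC = opC * opS A :=
  spinE_creE_comm A

theorem opA_opC_commutator : opA * opC - opC * opA = 1 := annE_creE_commutator

/-! ### Pairs of a sequence of finite-system operators and an operator of the limiting system -/

/-- Pairs of a sequence of operators of the finite systems, with `N + 1` bath spins, and an operator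
of the spin-boson system. -/
abbrev PairOp : Type := (∀ N : ℕ, FinOp (N + 1)) × FockOp

/-- `1 / √(N + 1)`. -/
def hbar (N : ℕ) : ℝ := 1 / √((N + 1 : ℕ) : ℝ)

theorem hbar_pos (N : ℕ) : 0 < hbar N := by rw [hbar]; positivity

theorem hbar_ne_zero (N : ℕ) : (hbar N : ℂ) ≠ 0 := by exact_mod_cast (hbar_pos N).ne'

theorem hbar_sq (N : ℕ) : hbar N ^ 2 = 1 / ((N + 1 : ℕ) : ℝ) := by
  rw [hbar, div_pow, one_pow, Real.sq_sqrt (by positivity)]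

theorem hbar_tendsto : Tendsto hbar atTop (𝓝 0) := by
  have h := (tendsto_const_div_atTop_nhds_zero_nat (1 : ℝ)).sqrt.comp (tendsto_add_atTop_nat 1)
  rw [Real.sqrt_zero] at h
  refine h.congr fun N => ?_
  simp [hbar]

/-- A spin operator in all systems. -/
def letS (A : Matrix (Fin 2) (Fin 2) ℂ) : PairOp := (fun _ => onSpin A, opS A)

/-- The scalar sequence `1 / √(N + 1)`, with limit `0`. -/
def letH : PairOp := (fun N => (hbar N : ℂ) • 1, 0)

/-- The operators `a_N` and their limit `a`. -/
def Params.letA (p : Params) : PairOp := (fun N => onBath (p.aN (N + 1)), opA)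

/-- The operators `a_N†` and their limit `a†`. -/
def Params.letC (p : Params) : PairOp := (fun N => onBath (p.aN (N + 1))ᴴ, opC)

/-- The operators `m_z^N` and their limit `-ε`. -/
def Params.letM (p : Params) : PairOp := (fun N => onBath (mz (N + 1)), (-p.ε : ℂ) • 1)

theorem onBath_aN (p : Params) (N : ℕ) : onBath (p.aN (N + 1)) =
    ((hbar N / √p.ε : ℝ) : ℂ) • ∑ k : Fin (N + 1), siteOp k lower := by
  rw [Params.aN, onBath_smul, onBath_collective, hbar, Real.sqrt_mul' _ (by positivity)]
  congr 2
  field_simp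

theorem onBath_aN_conj (p : Params) (N : ℕ) : onBath (p.aN (N + 1))ᴴ =
    ((hbar N / √p.ε : ℝ) : ℂ) • ∑ k : Fin (N + 1), siteOp k raise := by
  rw [← conjTranspose_onBath, onBath_aN, Matrix.conjTranspose_smul, Matrix.conjTranspose_sum]
  simp [conjTranspose_siteOp, raise]

theorem onBath_mz (N : ℕ) : onBath (mz (N + 1)) =
    ((hbar N ^ 2 : ℝ) : ℂ) • ∑ k : Fin (N + 1), siteOp k (pauli 3) := by
  rw [mz, onBath_smul, onBath_collective, hbar_sq]
  push_cast; rfl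

theorem pairOp_ext {X Y : PairOp} (h1 : ∀ N, X.1 N = Y.1 N) (h2 : X.2 = Y.2) : X = Y :=
  Prod.ext (funext h1) h2

theorem letS_mul (A B : Matrix (Fin 2) (Fin 2) ℂ) : letS (A * B) = letS A * letS B :=
  pairOp_ext (fun _ => onSpin_mul A B) (opS_mul A B)

theorem letS_one : letS 1 = 1 := pairOp_ext (fun _ => onSpin_one) opS_one

theorem letS_smul (c : ℂ) (A : Matrix (Fin 2) (Fin 2) ℂ) : letS (c • A) = c • letS A :=
  pairOp_ext (fun _ => onSpin_smul c A) (opS_smul c A)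

theorem letS_smul_one (c : ℂ) : letS (c • 1) = c • 1 := by rw [letS_smul, letS_one]

theorem letH_comm (X : PairOp) : letH * X = X * letH :=
  pairOp_ext (fun N => by
    change ((hbar N : ℂ) • 1) * X.1 N = X.1 N * ((hbar N : ℂ) • 1)
    rw [smul_mul_assoc, mul_smul_comm, one_mul, mul_one]) (by
    change 0 * X.2 = X.2 * 0
    rw [zero_mul, mul_zero])

theorem letH_mul_fst (X : PairOp) (N : ℕ) : (letH * X).1 N = (hbar N : ℂ) • X.1 N := by
  change ((hbar N : ℂ) • 1) * X.1 N = _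
  rw [smul_mul_assoc, one_mul]

theorem letH_mul_snd (X : PairOp) : (letH * X).2 = 0 := zero_mul X.2

theorem letS_letA_comm (p : Params) (A : Matrix (Fin 2) (Fin 2) ℂ) :
    letS A * p.letA = p.letA * letS A :=
  pairOp_ext (fun _ => onSpin_mul_onBath _ _) (opS_opA_comm A)

theorem letS_letC_comm (p : Params) (A : Matrix (Fin 2) (Fin 2) ℂ) :
    letS A * p.letC = p.letC * letS A :=
  pairOp_ext (fun _ => onSpin_mul_onBath _ _) (opS_opC_comm A)

theorem letS_letM_comm (p : Params) (A : Matrix (Fin 2) (Fin 2) ℂ) :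
    letS A * p.letM = p.letM * letS A :=
  pairOp_ext (fun _ => onSpin_mul_onBath _ _) (by
    change opS A * ((-p.ε : ℂ) • 1) = ((-p.ε : ℂ) • 1) * opS A
    rw [smul_mul_assoc, mul_smul_comm, one_mul, mul_one])

/-! ### Commutation relations of the letters -/

theorem smul_sub_smul_commutator {R : Type*} [Ring R] [Algebra ℂ R] (c d : ℂ) (X Y : R) :
    (c • X) * (d • Y) - (d • Y) * (c • X) = (c * d) • (X * Y - Y * X) := by
  simp only [smul_mul_assoc, mul_smul_comm, smul_smul, smul_sub, mul_comm]

/-- Distinct sites commute and `[σ₋, σ₊] = -σ_z` at each site. The canonical relation of the mode is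
the same identity with `m_z` replaced by its limit `-ε`. -/
theorem letA_letC_commutator {p : Params} (hp : p.Admissible) :
    p.letA * p.letC - p.letC * p.letA = (-(1 / p.ε) : ℂ) • p.letM := by
  refine pairOp_ext (fun N => ?_) ?_
  · change onBath (p.aN (N + 1)) * onBath (p.aN (N + 1))ᴴ -
      onBath (p.aN (N + 1))ᴴ * onBath (p.aN (N + 1)) = (-(1 / p.ε) : ℂ) • onBath (mz (N + 1))
    rw [onBath_aN_conj, onBath_aN, onBath_mz, smul_sub_smul_commutator, sum_siteOp_commutator,
      ← neg_sub, raise_lower_commutator, smul_smul]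
    have h : ∀ k : Fin (N + 1), siteOp k (-pauli 3) = (-1 : ℂ) • siteOp k (pauli 3) := fun k => by
      rw [← siteOp_smul, neg_one_smul]
    simp only [h, ← Finset.smul_sum, smul_smul]
    congr 1
    have h3 : hbar N / √p.ε * (hbar N / √p.ε) = hbar N ^ 2 / p.ε := by
      rw [div_mul_div_comm, Real.mul_self_sqrt hp.ε_pos.le, sq]
    rw [← Complex.ofReal_mul, h3]
    push_cast; ring
  · change opA * opC - opC * opA = (-(1 / p.ε) : ℂ) • ((-p.ε : ℂ) • 1)
    have : (p.ε : ℂ) ≠ 0 := by exact_mod_cast hp.ε_pos.ne'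
    rw [opA_opC_commutator, smul_smul, neg_mul_neg, one_div_mul_cancel this, one_smul]

/-- The average contributes `1/N`, written as two factors `letH`. They annihilate the limit
component, as they must because `-ε` is a scalar. -/
theorem letA_letM_commutator (p : Params) :
    p.letA * p.letM - p.letM * p.letA = (2 : ℂ) • (letH * (letH * p.letA)) := by
  refine pairOp_ext (fun N => ?_) ?_
  · change onBath (p.aN (N + 1)) * onBath (mz (N + 1)) -
      onBath (mz (N + 1)) * onBath (p.aN (N + 1)) = (2 : ℂ) • (letH * (letH * p.letA)).1 N
    rw [letH_mul_fst, letH_mul_fst]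
    change _ = (2 : ℂ) • (hbar N : ℂ) • (hbar N : ℂ) • onBath (p.aN (N + 1))
    rw [onBath_aN, onBath_mz, smul_sub_smul_commutator, sum_siteOp_commutator,
      lower_pauli_commutator]
    simp only [siteOp_smul, ← Finset.smul_sum, smul_smul]
    congr 1
    push_cast; ring
  · change opA * ((-p.ε : ℂ) • 1) - ((-p.ε : ℂ) • 1) * opA =
      (2 : ℂ) • (letH * (letH * p.letA)).2
    rw [letH_mul_snd, smul_zero, smul_mul_assoc, mul_smul_comm, one_mul, mul_one, sub_self]

theorem letC_letM_commutator (p : Params) :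
    p.letC * p.letM - p.letM * p.letC = (-2 : ℂ) • (letH * (letH * p.letC)) := by
  refine pairOp_ext (fun N => ?_) ?_
  · change onBath (p.aN (N + 1))ᴴ * onBath (mz (N + 1)) -
      onBath (mz (N + 1)) * onBath (p.aN (N + 1))ᴴ = (-2 : ℂ) • (letH * (letH * p.letC)).1 N
    rw [letH_mul_fst, letH_mul_fst]
    change _ = (-2 : ℂ) • (hbar N : ℂ) • (hbar N : ℂ) • onBath (p.aN (N + 1))ᴴ
    rw [onBath_aN_conj, onBath_mz, smul_sub_smul_commutator, sum_siteOp_commutator,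
      raise_pauli_commutator]
    simp only [siteOp_smul, ← Finset.smul_sum, smul_smul]
    congr 1
    push_cast; ring
  · change opC * ((-p.ε : ℂ) • 1) - ((-p.ε : ℂ) • 1) * opC =
      (-2 : ℂ) • (letH * (letH * p.letC)).2
    rw [letH_mul_snd, smul_zero, smul_mul_assoc, mul_smul_comm, one_mul, mul_one, sub_self]

/-! ### Families of operators that are local at a bath spin -/

/-- Pairs of a family of operators, indexed by the bath spins of the finite systems, and an operator
of the spin-boson system with an additional spin, which represents one bath spin. -/
abbrev LocOp : Type := (∀ N : ℕ, Fin (N + 1) → FinOp (N + 1)) × Matrix (Fin 2) (Fin 2) FockOp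

theorem locOp_ext {X Y : LocOp} (h1 : ∀ N k, X.1 N k = Y.1 N k) (h2 : X.2 = Y.2) : X = Y :=
  Prod.ext (funext fun N => funext fun k => h1 N k) h2

/-- A pair, as a family that does not depend on the bath spin. -/
def toLoc : PairOp →+* LocOp where
  toFun X := (fun N _ => X.1 N, Matrix.scalar (Fin 2) X.2)
  map_one' := locOp_ext (fun _ _ => rfl) (map_one _)
  map_mul' X Y := locOp_ext (fun _ _ => rfl) (map_mul _ X.2 Y.2)
  map_zero' := locOp_ext (fun _ _ => rfl) (map_zero _)
  map_add' X Y := locOp_ext (fun _ _ => rfl) (map_add _ X.2 Y.2)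

/-- A matrix of the additional spin. -/
def extraE (A : Matrix (Fin 2) (Fin 2) ℂ) : Matrix (Fin 2) (Fin 2) FockOp :=
  A.map (algebraMap ℂ FockOp)

theorem extraE_mul (A B : Matrix (Fin 2) (Fin 2) ℂ) : extraE (A * B) = extraE A * extraE B :=
  Matrix.map_mul

theorem extraE_smul (c : ℂ) (A : Matrix (Fin 2) (Fin 2) ℂ) : extraE (c • A) = c • extraE A := by
  ext i j : 1
  change algebraMap ℂ FockOp (c * A i j) = c • algebraMap ℂ FockOp (A i j)
  rw [map_mul, Algebra.smul_def]

theorem extraE_add (A B : Matrix (Fin 2) (Fin 2) ℂ) : extraE (A + B) = extraE A + extraE B := by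
  ext i j : 1
  simp [extraE]

theorem extraE_comm (A : Matrix (Fin 2) (Fin 2) ℂ) (T : FockOp) :
    extraE A * Matrix.scalar (Fin 2) T = Matrix.scalar (Fin 2) T * extraE A := by
  ext i j : 1
  simp only [extraE, Matrix.scalar_apply, Matrix.mul_diagonal, Matrix.diagonal_mul,
    Matrix.map_apply]
  exact Algebra.commutes _ _

/-- The one-spin operator `A` at each bath spin. -/
def locS (A : Matrix (Fin 2) (Fin 2) ℂ) : LocOp := (fun _ k => siteOp k A, extraE A)

theorem locS_mul (A B : Matrix (Fin 2) (Fin 2) ℂ) : locS (A * B) = locS A * locS B :=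
  locOp_ext (fun _ k => siteOp_mul k A B) (extraE_mul A B)

/-- The commutators with `A` at each bath spin, scaled by `√(N + 1)`, and their limit. -/
def Params.locComm (p : Params) (A : Matrix (Fin 2) (Fin 2) ℂ) (X : PairOp) : LocOp :=
  (fun N k => ((hbar N : ℂ))⁻¹ • (siteOp k A * X.1 N - X.1 N * siteOp k A),
    -- A derivation fixed by its values on the letters: `[·, a†]` differentiates in `a` and attaches
    -- `[A, σ₋]/√ε`, while `[a, ·]` differentiates in `a†` and attaches `[A, σ₊]/√ε`.
    ((1 / √p.ε : ℝ) : ℂ) •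
      (Matrix.scalar (Fin 2) (X.2 * opC - opC * X.2) * extraE (A * lower - lower * A) +
        Matrix.scalar (Fin 2) (opA * X.2 - X.2 * opA) * extraE (A * raise - raise * A)))

theorem Params.locComm_add (p : Params) (A : Matrix (Fin 2) (Fin 2) ℂ) (X Y : PairOp) :
    p.locComm A (X + Y) = p.locComm A X + p.locComm A Y := by
  refine locOp_ext (fun N k => ?_) ?_
  · change ((hbar N : ℂ))⁻¹ • (siteOp k A * (X.1 N + Y.1 N) - (X.1 N + Y.1 N) * siteOp k A) =
      ((hbar N : ℂ))⁻¹ • (siteOp k A * X.1 N - X.1 N * siteOp k A) +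
      ((hbar N : ℂ))⁻¹ • (siteOp k A * Y.1 N - Y.1 N * siteOp k A)
    rw [← smul_add, mul_add, add_mul]
    congr 1; abel
  · simp only [Params.locComm, Prod.snd_add]
    rw [← smul_add]
    exact congrArg _ (ringHom_commutator_add _ _ _ _ _ _ _)

theorem Params.locComm_mul (p : Params) (A : Matrix (Fin 2) (Fin 2) ℂ) (X Y : PairOp) :
    p.locComm A (X * Y) = p.locComm A X * toLoc Y + toLoc X * p.locComm A Y := by
  refine locOp_ext (fun N k => ?_) ?_
  · change ((hbar N : ℂ))⁻¹ • (siteOp k A * (X.1 N * Y.1 N) - (X.1 N * Y.1 N) * siteOp k A) =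
      (((hbar N : ℂ))⁻¹ • (siteOp k A * X.1 N - X.1 N * siteOp k A)) * Y.1 N +
      X.1 N * (((hbar N : ℂ))⁻¹ • (siteOp k A * Y.1 N - Y.1 N * siteOp k A))
    rw [smul_mul_assoc, mul_smul_comm, ← smul_add]
    congr 1
    noncomm_ring
  · simp only [Params.locComm, Prod.snd_add, Prod.snd_mul]
    change _ = _ * Matrix.scalar (Fin 2) Y.2 + Matrix.scalar (Fin 2) X.2 * _
    rw [smul_mul_assoc, mul_smul_comm, ← smul_add]
    exact congrArg _ (ringHom_commutator_mul _ _ _ _ _ (extraE_comm _ _) (extraE_comm _ _))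

/-- Moving a one-spin operator past a polynomial costs a factor `1/√(N + 1)`; in the limit the
additional spin commutes with the mode. -/
theorem Params.locS_mul_toLoc (p : Params) (A : Matrix (Fin 2) (Fin 2) ℂ) (X : PairOp) :
    locS A * toLoc X = toLoc X * locS A + toLoc letH * p.locComm A X := by
  refine locOp_ext (fun N k => ?_) ?_
  · change siteOp k A * X.1 N = X.1 N * siteOp k A + ((hbar N : ℂ) • 1) *
      (((hbar N : ℂ))⁻¹ • (siteOp k A * X.1 N - X.1 N * siteOp k A))
    rw [smul_mul_assoc, one_mul, smul_smul, mul_inv_cancel₀ (hbar_ne_zero N), one_smul]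
    abel
  · change extraE A * Matrix.scalar (Fin 2) X.2 = Matrix.scalar (Fin 2) X.2 * extraE A +
      Matrix.scalar (Fin 2) 0 * _
    rw [map_zero, zero_mul, add_zero, extraE_comm]

/-! ### Local commutators of the letters -/

theorem Params.locComm_letS (p : Params) (A B : Matrix (Fin 2) (Fin 2) ℂ) :
    p.locComm A (letS B) = 0 := by
  refine locOp_ext (fun N k => ?_) ?_
  · change ((hbar N : ℂ))⁻¹ • (siteOp k A * onSpin B - onSpin B * siteOp k A) = 0
    rw [onSpin_mul_siteOp, sub_self, smul_zero]
  · simp only [Params.locComm, letS, opS_opC_comm, opS_opA_comm, sub_self, map_zero,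
      zero_mul, add_zero, smul_zero, Prod.snd_zero]

theorem Params.locComm_letH (p : Params) (A : Matrix (Fin 2) (Fin 2) ℂ) :
    p.locComm A letH = 0 := by
  refine locOp_ext (fun N k => ?_) ?_
  · change ((hbar N : ℂ))⁻¹ • (siteOp k A * ((hbar N : ℂ) • 1) - ((hbar N : ℂ) • 1) * siteOp k A)
      = 0
    rw [smul_mul_assoc, mul_smul_comm, one_mul, mul_one, sub_self, smul_zero]
  · simp only [Params.locComm, letH, mul_zero, zero_mul, sub_self, map_zero, add_zero, smul_zero,
      Prod.snd_zero]

/-- Only the term of `a_N` at the same site contributes, and its normalization cancels the scaling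
by `√(N + 1)`. For `m_z` one factor `letH` is left over. -/
theorem Params.locComm_letA (p : Params) (A : Matrix (Fin 2) (Fin 2) ℂ) :
    p.locComm A p.letA = ((1 / √p.ε : ℝ) : ℂ) • locS (A * lower - lower * A) := by
  refine locOp_ext (fun N k => ?_) ?_
  · change ((hbar N : ℂ))⁻¹ • (siteOp k A * onBath (p.aN (N + 1)) -
      onBath (p.aN (N + 1)) * siteOp k A) = ((1 / √p.ε : ℝ) : ℂ) • siteOp k _
    rw [onBath_aN, smul_mul_assoc, mul_smul_comm, ← smul_sub, siteOp_commutator_sum, smul_smul]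
    congr 1
    have := hbar_ne_zero N
    push_cast; field_simp
  · simp only [Params.locComm, Params.letA, opA_opC_commutator, sub_self, map_zero, map_one,
      zero_mul, one_mul, add_zero]
    rfl

theorem Params.locComm_letC (p : Params) (A : Matrix (Fin 2) (Fin 2) ℂ) :
    p.locComm A p.letC = ((1 / √p.ε : ℝ) : ℂ) • locS (A * raise - raise * A) := by
  refine locOp_ext (fun N k => ?_) ?_
  · change ((hbar N : ℂ))⁻¹ • (siteOp k A * onBath (p.aN (N + 1))ᴴ -
      onBath (p.aN (N + 1))ᴴ * siteOp k A) = ((1 / √p.ε : ℝ) : ℂ) • siteOp k _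
    rw [onBath_aN_conj, smul_mul_assoc, mul_smul_comm, ← smul_sub, siteOp_commutator_sum,
      smul_smul]
    congr 1
    have := hbar_ne_zero N
    push_cast; field_simp
  · simp only [Params.locComm, Params.letC, opA_opC_commutator, sub_self, map_zero, map_one,
      zero_mul, one_mul, zero_add]
    rfl

theorem Params.locComm_letM (p : Params) (A : Matrix (Fin 2) (Fin 2) ℂ) :
    p.locComm A p.letM = toLoc letH * locS (A * pauli 3 - pauli 3 * A) := by
  refine locOp_ext (fun N k => ?_) ?_
  · change ((hbar N : ℂ))⁻¹ • (siteOp k A * onBath (mz (N + 1)) -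
      onBath (mz (N + 1)) * siteOp k A) = ((hbar N : ℂ) • 1) * siteOp k _
    rw [onBath_mz, smul_mul_assoc, smul_mul_assoc, mul_smul_comm, ← smul_sub,
      siteOp_commutator_sum, smul_smul, one_mul]
    congr 1
    have := hbar_ne_zero N
    push_cast; field_simp
  · change _ = Matrix.scalar (Fin 2) 0 * _
    simp only [Params.locComm, Params.letM, smul_mul_assoc, mul_smul_comm, one_mul, mul_one,
      sub_self, map_zero, zero_mul, add_zero, smul_zero]

/-! ### Averages over the bath -/

/-- The averages over the bath spins, and the expectation in the state of the additional spin. -/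
def Params.bathAvg (p : Params) : LocOp →+ PairOp where
  toFun T := (fun N => ((hbar N ^ 2 : ℝ) : ℂ) • ∑ k, T.1 N k,
    ((p.ΓUp / p.ΓPlus : ℝ) : ℂ) • T.2 0 0 + ((p.ΓDown / p.ΓPlus : ℝ) : ℂ) • T.2 1 1)
  map_zero' := pairOp_ext (fun N => by simp) (by simp)
  map_add' S T := pairOp_ext (fun N => by
    change ((hbar N ^ 2 : ℝ) : ℂ) • ∑ k, (S.1 N k + T.1 N k) =
      ((hbar N ^ 2 : ℝ) : ℂ) • ∑ k, S.1 N k + ((hbar N ^ 2 : ℝ) : ℂ) • ∑ k, T.1 N k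
    rw [Finset.sum_add_distrib, smul_add]) (by
    simp only [Prod.snd_add, Matrix.add_apply, smul_add]; abel)

theorem Params.bathAvg_toLoc_mul (p : Params) (X : PairOp) (T : LocOp) :
    p.bathAvg (toLoc X * T) = X * p.bathAvg T := by
  refine pairOp_ext (fun N => ?_) ?_
  · change ((hbar N ^ 2 : ℝ) : ℂ) • ∑ k, X.1 N * T.1 N k =
      X.1 N * (((hbar N ^ 2 : ℝ) : ℂ) • ∑ k, T.1 N k)
    rw [mul_smul_comm, Finset.mul_sum]
  · change ((p.ΓUp / p.ΓPlus : ℝ) : ℂ) • (Matrix.scalar (Fin 2) X.2 * T.2) 0 0 +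
      ((p.ΓDown / p.ΓPlus : ℝ) : ℂ) • (Matrix.scalar (Fin 2) X.2 * T.2) 1 1 =
      X.2 * (((p.ΓUp / p.ΓPlus : ℝ) : ℂ) • T.2 0 0 + ((p.ΓDown / p.ΓPlus : ℝ) : ℂ) • T.2 1 1)
    simp only [Matrix.scalar_apply, Matrix.diagonal_mul, mul_add, mul_smul_comm]

theorem locS_add (A B : Matrix (Fin 2) (Fin 2) ℂ) : locS (A + B) = locS A + locS B :=
  locOp_ext (fun _ k => siteOp_add k A B) (extraE_add A B)

theorem toLoc_smul_one (c : ℂ) : toLoc (c • 1) = c • 1 :=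
  locOp_ext (fun _ _ => rfl) (by
    change Matrix.scalar (Fin 2) (c • (1 : FockOp)) = c • (1 : Matrix (Fin 2) (Fin 2) FockOp)
    ext i j : 1
    by_cases h : i = j
    · subst h; simp
    · simp [h])

theorem locOp_smul_eq (c : ℂ) (T : LocOp) : c • T = toLoc (c • 1) * T := by
  rw [toLoc_smul_one, smul_mul_assoc, one_mul]

theorem Params.bathAvg_smul (p : Params) (c : ℂ) (T : LocOp) :
    p.bathAvg (c • T) = c • p.bathAvg T := by
  rw [locOp_smul_eq, bathAvg_toLoc_mul, smul_mul_assoc, one_mul]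

theorem locS_smul (c : ℂ) (A : Matrix (Fin 2) (Fin 2) ℂ) : locS (c • A) = c • locS A :=
  locOp_ext (fun _ k => siteOp_smul k c A) (extraE_smul c A)

theorem Params.Admissible.bathAvg_one {p : Params} (hp : p.Admissible) :
    p.bathAvg (locS 1) = 1 := by
  refine pairOp_ext (fun N => ?_) ?_
  · change ((hbar N ^ 2 : ℝ) : ℂ) • ∑ k : Fin (N + 1), siteOp k 1 = 1
    simp only [siteOp_one, Finset.sum_const, Finset.card_univ, Fintype.card_fin, hbar_sq]
    rw [← Nat.cast_smul_eq_nsmul ℂ, smul_smul]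
    have : ((N + 1 : ℕ) : ℂ) ≠ 0 := by exact_mod_cast N.succ_ne_zero
    push_cast at this ⊢
    rw [one_div_mul_cancel this, one_smul]
  · change ((p.ΓUp / p.ΓPlus : ℝ) : ℂ) • extraE 1 0 0 + ((p.ΓDown / p.ΓPlus : ℝ) : ℂ) • extraE 1 1 1
      = 1
    have h : p.ΓUp / p.ΓPlus + p.ΓDown / p.ΓPlus = 1 := by
      rw [← add_div, ← Params.ΓPlus, div_self hp.plus_pos.ne']
    simp only [extraE, Matrix.map_apply, Matrix.one_apply_eq, map_one, ← add_smul]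
    rw [← Complex.ofReal_add, h, Complex.ofReal_one, one_smul]

theorem Params.Admissible.bathAvg_pauli {p : Params} (hp : p.Admissible) :
    p.bathAvg (locS (pauli 3)) = p.letM := by
  refine pairOp_ext (fun N => (onBath_mz N).symm) ?_
  change ((p.ΓUp / p.ΓPlus : ℝ) : ℂ) • extraE (pauli 3) 0 0 +
    ((p.ΓDown / p.ΓPlus : ℝ) : ℂ) • extraE (pauli 3) 1 1 = (-p.ε : ℂ) • 1
  have h : p.ΓUp / p.ΓPlus - p.ΓDown / p.ΓPlus = -p.ε := by
    have := hp.plus_pos.ne'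
    rw [Params.ε, Params.ΓMinus]; field_simp
  simp only [extraE, Matrix.map_apply, pauli_three]
  simp only [Matrix.of_apply, Matrix.cons_val', Matrix.cons_val_zero, Matrix.cons_val_one,
    Matrix.cons_val_fin_one, map_one, map_neg, smul_neg]
  rw [← Complex.ofReal_neg, ← h, Complex.ofReal_sub]
  module

/-- `S₋/N` is the fluctuation `a_N` up to a factor `√ε/√N`, so this average is small, in accordance
with `Ω_SS(σ₋) = 0`. -/
theorem Params.Admissible.bathAvg_lower {p : Params} (hp : p.Admissible) :
    p.bathAvg (locS lower) = ((√p.ε : ℝ) : ℂ) • (letH * p.letA) := by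
  have hε := (Real.sqrt_pos.2 hp.ε_pos).ne'
  refine pairOp_ext (fun N => ?_) ?_
  · change ((hbar N ^ 2 : ℝ) : ℂ) • ∑ k : Fin (N + 1), siteOp k lower =
      ((√p.ε : ℝ) : ℂ) • (letH * p.letA).1 N
    rw [letH_mul_fst]
    change _ = ((√p.ε : ℝ) : ℂ) • (hbar N : ℂ) • onBath (p.aN (N + 1))
    rw [onBath_aN, smul_smul, smul_smul, ← Complex.ofReal_mul, ← Complex.ofReal_mul]
    congr 2
    field_simp
  · change ((p.ΓUp / p.ΓPlus : ℝ) : ℂ) • extraE lower 0 0 +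
      ((p.ΓDown / p.ΓPlus : ℝ) : ℂ) • extraE lower 1 1 = ((√p.ε : ℝ) : ℂ) • (letH * p.letA).2
    rw [letH_mul_snd]
    simp [extraE, lower]

theorem Params.Admissible.bathAvg_raise {p : Params} (hp : p.Admissible) :
    p.bathAvg (locS raise) = ((√p.ε : ℝ) : ℂ) • (letH * p.letC) := by
  have hε := (Real.sqrt_pos.2 hp.ε_pos).ne'
  refine pairOp_ext (fun N => ?_) ?_
  · change ((hbar N ^ 2 : ℝ) : ℂ) • ∑ k : Fin (N + 1), siteOp k raise =
      ((√p.ε : ℝ) : ℂ) • (letH * p.letC).1 N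
    rw [letH_mul_fst]
    change _ = ((√p.ε : ℝ) : ℂ) • (hbar N : ℂ) • onBath (p.aN (N + 1))ᴴ
    rw [onBath_aN_conj, smul_smul, smul_smul, ← Complex.ofReal_mul, ← Complex.ofReal_mul]
    congr 2
    field_simp
  · change ((p.ΓUp / p.ΓPlus : ℝ) : ℂ) • extraE raise 0 0 +
      ((p.ΓDown / p.ΓPlus : ℝ) : ℂ) • extraE raise 1 1 = ((√p.ε : ℝ) : ℂ) • (letH * p.letC).2
    rw [letH_mul_snd]
    simp [extraE, raise_eq]

/-! ### The dissipator of the bath -/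

theorem lindblad_smul {R : Type*} [Ring R] [Algebra ℂ R] (V W X : R) (c : ℂ) :
    lindblad V W (c • X) = c • lindblad V W X := by
  simp only [lindblad, mul_smul_comm, smul_mul_assoc, smul_sub, smul_add, smul_smul, mul_comm]

/-- The dissipator of the bath spins, and the dissipator of the bosonic mode. -/
def Params.bathDiss (p : Params) (X : PairOp) : PairOp :=
  (fun N => ∑ k : Fin (N + 1),
    ((p.ΓDown : ℂ) • lindblad (siteOp k lower) (siteOp k raise) (X.1 N)
      + (p.ΓUp : ℂ) • lindblad (siteOp k raise) (siteOp k lower) (X.1 N)),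
    (p.κDown : ℂ) • lindblad opA opC X.2 + (p.κUp : ℂ) • lindblad opC opA X.2)

theorem Params.bathDiss_add (p : Params) (X Y : PairOp) :
    p.bathDiss (X + Y) = p.bathDiss X + p.bathDiss Y := by
  refine pairOp_ext (fun N => ?_) ?_
  · simp only [Params.bathDiss, Prod.fst_add, Pi.add_apply, lindblad_add, smul_add,
      ← Finset.sum_add_distrib]
    exact Finset.sum_congr rfl fun k _ => by abel
  · simp only [Params.bathDiss, Prod.snd_add, lindblad_add, smul_add]
    abel

theorem locComm_raise_snd (p : Params) (X : PairOp) : (p.locComm raise X).2 =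
    ((1 / √p.ε : ℝ) : ℂ) • (Matrix.scalar (Fin 2) (X.2 * opC - opC * X.2) * extraE (pauli 3)) := by
  have h0 : extraE 0 = 0 := by ext i j : 1; simp [extraE]
  rw [Params.locComm, raise_lower_commutator, sub_self, h0, mul_zero, add_zero]

theorem locComm_lower_snd (p : Params) (X : PairOp) : (p.locComm lower X).2 =
    ((1 / √p.ε : ℝ) : ℂ) •
      (Matrix.scalar (Fin 2) (opA * X.2 - X.2 * opA) * extraE (-pauli 3)) := by
  have h0 : extraE 0 = 0 := by ext i j : 1; simp [extraE]
  rw [Params.locComm, ← raise_lower_commutator, sub_self, h0, mul_zero, zero_add, neg_sub]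

theorem scalar_mul_extraE_mul (S T : FockOp) (A B : Matrix (Fin 2) (Fin 2) ℂ) :
    (Matrix.scalar (Fin 2) S * extraE A) * (Matrix.scalar (Fin 2) T * extraE B) =
      Matrix.scalar (Fin 2) (S * T) * extraE (A * B) := by
  rw [mul_assoc, ← mul_assoc (extraE A), extraE_comm, extraE_mul, map_mul]
  simp only [mul_assoc]

theorem pauli_three_sq : pauli 3 * pauli 3 = 1 := by
  rw [pauli_three]; ext i j; fin_cases i <;> fin_cases j <;> simp

theorem scalar_mul_extraE_one_apply (S : FockOp) (i : Fin 2) :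
    (Matrix.scalar (Fin 2) S * extraE ((-1 : ℂ) • 1)) i i = -S := by
  simp [extraE, Matrix.diagonal_mul]

theorem Params.Admissible.κDown_eq {p : Params} (hp : p.Admissible) :
    p.κDown = p.ΓDown / p.ε := by
  have := hp.ε_pos.ne'
  rw [Params.κDown]; field_simp; rw [hp.plus_mul_ε]; ring

/-- The dissipator of the bath is a derivation up to the average of a product of local
commutators. -/
theorem Params.Admissible.bathDiss_mul {p : Params} (hp : p.Admissible) (X Y : PairOp) :
    p.bathDiss (X * Y) = p.bathDiss X * Y + X * p.bathDiss Y -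
      p.bathAvg ((p.ΓDown : ℂ) • (p.locComm raise X * p.locComm lower Y) +
        (p.ΓUp : ℂ) • (p.locComm lower X * p.locComm raise Y)) := by
  refine pairOp_ext (fun N => ?_) ?_
  · change ∑ k : Fin (N + 1),
        ((p.ΓDown : ℂ) • lindblad (siteOp k lower) (siteOp k raise) (X.1 N * Y.1 N)
        + (p.ΓUp : ℂ) • lindblad (siteOp k raise) (siteOp k lower) (X.1 N * Y.1 N)) =
      (∑ k : Fin (N + 1), ((p.ΓDown : ℂ) • lindblad (siteOp k lower) (siteOp k raise) (X.1 N)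
        + (p.ΓUp : ℂ) • lindblad (siteOp k raise) (siteOp k lower) (X.1 N))) * Y.1 N +
      X.1 N * (∑ k : Fin (N + 1),
        ((p.ΓDown : ℂ) • lindblad (siteOp k lower) (siteOp k raise) (Y.1 N)
        + (p.ΓUp : ℂ) • lindblad (siteOp k raise) (siteOp k lower) (Y.1 N))) -
      ((hbar N ^ 2 : ℝ) : ℂ) • ∑ k : Fin (N + 1),
        ((p.ΓDown : ℂ) • ((((hbar N : ℂ))⁻¹ • (siteOp k raise * X.1 N - X.1 N * siteOp k raise)) *
          (((hbar N : ℂ))⁻¹ • (siteOp k lower * Y.1 N - Y.1 N * siteOp k lower))) +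
        (p.ΓUp : ℂ) • ((((hbar N : ℂ))⁻¹ • (siteOp k lower * X.1 N - X.1 N * siteOp k lower)) *
          (((hbar N : ℂ))⁻¹ • (siteOp k raise * Y.1 N - Y.1 N * siteOp k raise))))
    rw [Finset.sum_mul, Finset.mul_sum, Finset.smul_sum, ← Finset.sum_add_distrib,
      ← Finset.sum_sub_distrib]
    refine Finset.sum_congr rfl fun k _ => ?_
    -- The two scalings by `√(N + 1)` cancel the `1/(N + 1)` of the average exactly.
    have h : ∀ (c : ℂ) (S T : FinOp (N + 1)), ((hbar N ^ 2 : ℝ) : ℂ) •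
        (c • (((hbar N : ℂ))⁻¹ • S * ((hbar N : ℂ))⁻¹ • T)) = c • (S * T) := by
      intro c S T
      rw [smul_mul_assoc, mul_smul_comm, smul_smul, smul_smul, smul_smul]
      congr 1
      have := hbar_ne_zero N
      push_cast; field_simp
    rw [smul_add, h, h, lindblad_mul, lindblad_mul, mul_add, add_mul]
    simp only [smul_add, mul_smul_comm, smul_mul_assoc]
    rw [← neg_sub (siteOp k lower * Y.1 N), ← neg_sub (siteOp k raise * Y.1 N)]
    simp only [mul_neg, smul_neg]
    abel
  -- In the limit the two factors `1/√ε` turn `Γ_down`, `Γ_up` into `κ_down`, `κ_up`. The matrices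
  -- of the additional spin multiply to `-σ_z² = -1`, whose average is `-1`.
  · have hε : ((1 / √p.ε : ℝ) : ℂ) * ((1 / √p.ε : ℝ) : ℂ) = 1 / (p.ε : ℂ) := by
      rw [← Complex.ofReal_mul, div_mul_div_comm, Real.mul_self_sqrt hp.ε_pos.le]
      push_cast; ring
    have h1 : (p.locComm raise X * p.locComm lower Y).2 = (1 / (p.ε : ℂ)) •
        (Matrix.scalar (Fin 2) ((X.2 * opC - opC * X.2) * (opA * Y.2 - Y.2 * opA)) *
          extraE ((-1 : ℂ) • 1)) := by
      rw [Prod.snd_mul, locComm_raise_snd, locComm_lower_snd, smul_mul_assoc, mul_smul_comm,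
        smul_smul, hε, scalar_mul_extraE_mul, mul_neg, pauli_three_sq, neg_one_smul]
    have h2 : (p.locComm lower X * p.locComm raise Y).2 = (1 / (p.ε : ℂ)) •
        (Matrix.scalar (Fin 2) ((opA * X.2 - X.2 * opA) * (Y.2 * opC - opC * Y.2)) *
          extraE ((-1 : ℂ) • 1)) := by
      rw [Prod.snd_mul, locComm_raise_snd, locComm_lower_snd, smul_mul_assoc, mul_smul_comm,
        smul_smul, hε, scalar_mul_extraE_mul, neg_mul, pauli_three_sq, neg_one_smul]
    have h3 : ∀ (c d : ℂ) (S T : LocOp), (p.bathAvg (c • S + d • T)).2 =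
      ((p.ΓUp / p.ΓPlus : ℝ) : ℂ) • (c • S.2 + d • T.2) 0 0 +
      ((p.ΓDown / p.ΓPlus : ℝ) : ℂ) • (c • S.2 + d • T.2) 1 1 := fun _ _ _ _ => rfl
    rw [Prod.snd_sub, h3, h1, h2]
    simp only [Matrix.add_apply, Matrix.smul_apply, scalar_mul_extraE_one_apply]
    rw [← add_smul, ← Complex.ofReal_add, ← add_div, ← Params.ΓPlus, div_self hp.plus_pos.ne',
      Complex.ofReal_one, one_smul]
    change (p.κDown : ℂ) • lindblad opA opC (X.2 * Y.2) + (p.κUp : ℂ) •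
      lindblad opC opA (X.2 * Y.2) = ((p.κDown : ℂ) • lindblad opA opC X.2 + (p.κUp : ℂ) •
      lindblad opC opA X.2) * Y.2 + X.2 * ((p.κDown : ℂ) • lindblad opA opC Y.2 + (p.κUp : ℂ) •
      lindblad opC opA Y.2) - _
    have hd : (p.κDown : ℂ) = p.ΓDown * (1 / p.ε) := by rw [hp.κDown_eq]; push_cast; ring
    have hu : (p.κUp : ℂ) = p.ΓUp * (1 / p.ε) := by rw [Params.κUp]; push_cast; ring
    rw [hd, hu, lindblad_mul, lindblad_mul, add_mul, mul_add]
    simp only [smul_add, mul_smul_comm, smul_mul_assoc, smul_smul, mul_sub, sub_mul, smul_sub,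
      smul_neg]
    abel

/-- Both commutators in `lindblad_eq_commutators` reduce to the term of the collective operator at
site `k`. -/
theorem lindblad_siteOp_sum {N : ℕ} (k : Fin N) (V W B : Matrix (Fin 2) (Fin 2) ℂ) :
    lindblad (siteOp k V) (siteOp k W) (∑ l, siteOp l B) = siteOp k (lindblad V W B) := by
  rw [lindblad_eq_commutators, lindblad_eq_commutators, siteOp_commutator_sum,
    ← neg_sub (siteOp k V * _), siteOp_commutator_sum, ← neg_sub (V * B)]
  simp only [siteOp_smul, siteOp_add, siteOp_mul]
  rw [← neg_one_smul ℂ (V * B - B * V), siteOp_smul, neg_one_smul]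

theorem sum_lindblad_siteOp_sum {N : ℕ} (g g' c : ℂ) (B : Matrix (Fin 2) (Fin 2) ℂ) :
    ∑ k : Fin N, (g • lindblad (siteOp k lower) (siteOp k raise) (c • ∑ l, siteOp l B) +
      g' • lindblad (siteOp k raise) (siteOp k lower) (c • ∑ l, siteOp l B)) =
    c • ∑ k : Fin N, siteOp k (g • lindblad lower raise B + g' • lindblad raise lower B) := by
  simp only [lindblad_smul, lindblad_siteOp_sum]
  rw [Finset.smul_sum]
  refine Finset.sum_congr rfl fun k _ => ?_
  rw [siteOp_add, siteOp_smul, siteOp_smul, smul_add, smul_comm g, smul_comm g']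

/-! ### Action of the bath dissipator on the letters -/

theorem lindblad_bath_lower (g g' : ℂ) :
    g • lindblad lower raise lower + g' • lindblad raise lower lower =
      (-((g' + g) / 2)) • lower := by
  rw [lindblad, lindblad, raise_eq, lower]
  ext i j; fin_cases i <;> fin_cases j <;> simp <;> ring

theorem lindblad_bath_raise (g g' : ℂ) :
    g • lindblad lower raise raise + g' • lindblad raise lower raise =
      (-((g' + g) / 2)) • raise := by
  rw [lindblad, lindblad, raise_eq, lower]
  ext i j; fin_cases i <;> fin_cases j <;> simp <;> ring

theorem lindblad_bath_pauli (g g' : ℂ) :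
    g • lindblad lower raise (pauli 3) + g' • lindblad raise lower (pauli 3) =
      (g' - g) • 1 + (-(g' + g)) • pauli 3 := by
  rw [lindblad, lindblad, raise_eq, lower, pauli_three]
  ext i j; fin_cases i <;> fin_cases j <;> simp <;> ring

theorem Params.ΓPlus_cast (p : Params) : (p.ΓPlus : ℂ) = p.ΓUp + p.ΓDown := by
  rw [Params.ΓPlus]; push_cast; rfl

theorem Params.κ_cast (p : Params) : (p.κDown : ℂ) = p.ΓPlus + p.κUp := by
  rw [Params.κDown, Params.κUp]; push_cast; rfl

theorem Params.bathDiss_letS (p : Params) (A : Matrix (Fin 2) (Fin 2) ℂ) :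
    p.bathDiss (letS A) = 0 := by
  refine pairOp_ext (fun N => ?_) ?_
  · change ∑ k : Fin (N + 1), _ = (0 : FinOp (N + 1))
    refine Finset.sum_eq_zero fun k _ => ?_
    change (p.ΓDown : ℂ) • lindblad (siteOp k lower) (siteOp k raise) (onSpin A) +
      (p.ΓUp : ℂ) • lindblad (siteOp k raise) (siteOp k lower) (onSpin A) = 0
    rw [lindblad_of_commute (onSpin_mul_siteOp k A _).symm (onSpin_mul_siteOp k A _).symm,
      lindblad_of_commute (onSpin_mul_siteOp k A _).symm (onSpin_mul_siteOp k A _).symm,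
      smul_zero, smul_zero, add_zero]
  · change (p.κDown : ℂ) • lindblad opA opC (opS A) + (p.κUp : ℂ) • lindblad opC opA (opS A) = 0
    rw [lindblad_of_commute (opS_opA_comm A).symm (opS_opC_comm A).symm,
      lindblad_of_commute (opS_opC_comm A).symm (opS_opA_comm A).symm, smul_zero, smul_zero,
      add_zero]

theorem Params.bathDiss_letH (p : Params) : p.bathDiss letH = 0 := by
  refine pairOp_ext (fun N => ?_) ?_
  · change ∑ k : Fin (N + 1), _ = (0 : FinOp (N + 1))
    refine Finset.sum_eq_zero fun k _ => ?_
    change (p.ΓDown : ℂ) • lindblad (siteOp k lower) (siteOp k raise) ((hbar N : ℂ) • 1) +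
      (p.ΓUp : ℂ) • lindblad (siteOp k raise) (siteOp k lower) ((hbar N : ℂ) • 1) = 0
    rw [lindblad_smul, lindblad_smul, lindblad_of_commute (by simp) (by simp),
      lindblad_of_commute (by simp) (by simp)]
    simp
  · change (p.κDown : ℂ) • lindblad opA opC 0 + (p.κUp : ℂ) • lindblad opC opA 0 = 0
    simp [lindblad]

/-- A bath coherence decays at rate `Γ₊/2` and the mode at rate `(κ_down - κ_up)/2`; these agree
because `κ_down - κ_up = Γ₊`. -/
theorem Params.bathDiss_letA (p : Params) :
    p.bathDiss p.letA = (-((p.ΓUp + p.ΓDown) / 2) : ℂ) • p.letA := by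
  refine pairOp_ext (fun N => ?_) ?_
  · change ∑ k : Fin (N + 1), ((p.ΓDown : ℂ) • lindblad (siteOp k lower) (siteOp k raise)
      (onBath (p.aN (N + 1))) + (p.ΓUp : ℂ) • lindblad (siteOp k raise) (siteOp k lower)
      (onBath (p.aN (N + 1)))) = (-((p.ΓUp + p.ΓDown) / 2) : ℂ) • onBath (p.aN (N + 1))
    rw [onBath_aN, sum_lindblad_siteOp_sum, lindblad_bath_lower]
    simp only [siteOp_smul, ← Finset.smul_sum]
    rw [smul_comm]
  · change (p.κDown : ℂ) • lindblad opA opC opA + (p.κUp : ℂ) • lindblad opC opA opA =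
      (-((p.ΓUp + p.ΓDown) / 2) : ℂ) • opA
    rw [lindblad_eq_commutators, lindblad_eq_commutators, sub_self, ← neg_sub (opA * opC),
      opA_opC_commutator, p.κ_cast, p.ΓPlus_cast]
    simp only [mul_zero, zero_add, neg_mul, one_mul, mul_one, zero_mul, add_zero]
    module

theorem Params.bathDiss_letC (p : Params) :
    p.bathDiss p.letC = (-((p.ΓUp + p.ΓDown) / 2) : ℂ) • p.letC := by
  refine pairOp_ext (fun N => ?_) ?_
  · change ∑ k : Fin (N + 1), ((p.ΓDown : ℂ) • lindblad (siteOp k lower) (siteOp k raise)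
      (onBath (p.aN (N + 1))ᴴ) + (p.ΓUp : ℂ) • lindblad (siteOp k raise) (siteOp k lower)
      (onBath (p.aN (N + 1))ᴴ)) = (-((p.ΓUp + p.ΓDown) / 2) : ℂ) • onBath (p.aN (N + 1))ᴴ
    rw [onBath_aN_conj, sum_lindblad_siteOp_sum, lindblad_bath_raise]
    simp only [siteOp_smul, ← Finset.smul_sum]
    rw [smul_comm]
  · change (p.κDown : ℂ) • lindblad opA opC opC + (p.κUp : ℂ) • lindblad opC opA opC =
      (-((p.ΓUp + p.ΓDown) / 2) : ℂ) • opC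
    rw [lindblad_eq_commutators, lindblad_eq_commutators, sub_self, ← neg_sub (opA * opC),
      opA_opC_commutator, p.κ_cast, p.ΓPlus_cast]
    simp only [mul_zero, zero_add, mul_neg, one_mul, mul_one, zero_mul, add_zero]
    module

/-- The average relaxes to its stationary value. The right side vanishes at `m_z = -ε`, consistently
with a scalar limit, which the emergent dissipator annihilates. -/
theorem Params.Admissible.bathDiss_letM {p : Params} (hp : p.Admissible) :
    p.bathDiss p.letM = (p.ΓUp - p.ΓDown : ℂ) • 1 + (-(p.ΓUp + p.ΓDown) : ℂ) • p.letM := by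
  refine pairOp_ext (fun N => ?_) ?_
  · change ∑ k : Fin (N + 1), ((p.ΓDown : ℂ) • lindblad (siteOp k lower) (siteOp k raise)
      (onBath (mz (N + 1))) + (p.ΓUp : ℂ) • lindblad (siteOp k raise) (siteOp k lower)
      (onBath (mz (N + 1)))) =
      (p.ΓUp - p.ΓDown : ℂ) • 1 + (-(p.ΓUp + p.ΓDown) : ℂ) • onBath (mz (N + 1))
    have h1 : ((hbar N ^ 2 : ℝ) : ℂ) • ∑ k : Fin (N + 1), siteOp k 1 = 1 :=
      congrFun (congrArg Prod.fst hp.bathAvg_one) N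
    rw [onBath_mz, sum_lindblad_siteOp_sum, lindblad_bath_pauli]
    simp only [siteOp_add, siteOp_smul, ← Finset.smul_sum, Finset.sum_add_distrib]
    rw [smul_add, smul_comm _ (p.ΓUp - p.ΓDown : ℂ), h1, smul_comm _ (-(p.ΓUp + p.ΓDown) : ℂ)]
  · change (p.κDown : ℂ) • lindblad opA opC ((-p.ε : ℂ) • 1) + (p.κUp : ℂ) • lindblad opC opA
      ((-p.ε : ℂ) • 1) = (p.ΓUp - p.ΓDown : ℂ) • 1 + (-(p.ΓUp + p.ΓDown) : ℂ) • (-p.ε : ℂ) • 1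
    rw [lindblad_smul, lindblad_smul, lindblad_of_commute (by simp) (by simp),
      lindblad_of_commute (by simp) (by simp), smul_zero, smul_zero, smul_zero,
      add_zero, smul_smul, ← add_smul]
    have h := congrArg (fun x : ℝ => (x : ℂ)) hp.plus_mul_ε
    simp only [Complex.ofReal_mul, Complex.ofReal_sub, p.ΓPlus_cast] at h
    have h2 : (p.ΓUp - p.ΓDown : ℂ) + -(p.ΓUp + p.ΓDown : ℂ) * -p.ε = 0 := by
      linear_combination h
    rw [h2, zero_smul]

/-! ### Polynomials in the letters -/

/-- Polynomials in the letters whose words contain at most `n` letters `a`, `a†` and `m_z`. -/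
inductive Params.Filt (p : Params) : ℕ → PairOp → Prop
  | spin (n : ℕ) (A : Matrix (Fin 2) (Fin 2) ℂ) : Params.Filt p n (letS A)
  | add {n : ℕ} {X Y : PairOp} : Params.Filt p n X → Params.Filt p n Y → Params.Filt p n (X + Y)
  -- Factors `letH` are not counted: commutators of letters produce them, and the induction must not
  -- pay for them.
  | small {n : ℕ} {X : PairOp} : Params.Filt p n X → Params.Filt p n (letH * X)
  | ann {n : ℕ} {X : PairOp} : Params.Filt p n X → Params.Filt p (n + 1) (p.letA * X)
  | cre {n : ℕ} {X : PairOp} : Params.Filt p n X → Params.Filt p (n + 1) (p.letC * X)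
  | avg {n : ℕ} {X : PairOp} : Params.Filt p n X → Params.Filt p (n + 1) (p.letM * X)

namespace Params.Filt

variable {p : Params} {n m : ℕ} {X Y : PairOp}

theorem mono (hX : p.Filt n X) (h : n ≤ m) : p.Filt m X := by
  induction hX generalizing m with
  | spin n A => exact spin m A
  | add _ _ ih1 ih2 => exact add (ih1 h) (ih2 h)
  | small _ ih => exact small (ih h)
  | ann _ ih =>
    obtain ⟨m, rfl⟩ := Nat.exists_eq_succ_of_ne_zero (Nat.ne_of_gt ((Nat.succ_pos _).trans_le h))
    exact ann (ih (Nat.le_of_succ_le_succ h))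
  | cre _ ih =>
    obtain ⟨m, rfl⟩ := Nat.exists_eq_succ_of_ne_zero (Nat.ne_of_gt ((Nat.succ_pos _).trans_le h))
    exact cre (ih (Nat.le_of_succ_le_succ h))
  | avg _ ih =>
    obtain ⟨m, rfl⟩ := Nat.exists_eq_succ_of_ne_zero (Nat.ne_of_gt ((Nat.succ_pos _).trans_le h))
    exact avg (ih (Nat.le_of_succ_le_succ h))

theorem letS_mul (hX : p.Filt n X) (B : Matrix (Fin 2) (Fin 2) ℂ) : p.Filt n (letS B * X) := by
  induction hX with
  | spin n A => rw [← CentralSpin.letS_mul]; exact spin n _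
  | add _ _ ih1 ih2 => rw [mul_add]; exact add ih1 ih2
  | small _ ih => rw [← mul_assoc, ← letH_comm, mul_assoc]; exact small ih
  | ann _ ih => rw [← mul_assoc, letS_letA_comm, mul_assoc]; exact ann ih
  | cre _ ih => rw [← mul_assoc, letS_letC_comm, mul_assoc]; exact cre ih
  | avg _ ih => rw [← mul_assoc, letS_letM_comm, mul_assoc]; exact avg ih

theorem smul (hX : p.Filt n X) (c : ℂ) : p.Filt n (c • X) := by
  have h := hX.letS_mul (c • 1)
  rwa [letS_smul_one, smul_mul_assoc, one_mul] at h

theorem one (n : ℕ) : p.Filt n 1 := by rw [← letS_one]; exact spin n 1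

theorem zero (n : ℕ) : p.Filt n 0 := by rw [← zero_smul ℂ (1 : PairOp)]; exact (one n).smul 0

theorem neg (hX : p.Filt n X) : p.Filt n (-X) := by rw [← neg_one_smul ℂ]; exact hX.smul _

theorem sub (hX : p.Filt n X) (hY : p.Filt n Y) : p.Filt n (X - Y) := by
  rw [sub_eq_add_neg]; exact hX.add hY.neg

theorem mul (hX : p.Filt n X) (hY : p.Filt m Y) : p.Filt (n + m) (X * Y) := by
  induction hX with
  | spin n A => exact (hY.letS_mul A).mono (Nat.le_add_left _ _)
  | add _ _ ih1 ih2 => rw [add_mul]; exact ih1.add ih2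
  | small _ ih => rw [mul_assoc]; exact ih.small
  | ann _ ih => rw [mul_assoc, Nat.add_right_comm]; exact ih.ann
  | cre _ ih => rw [mul_assoc, Nat.add_right_comm]; exact ih.cre
  | avg _ ih => rw [mul_assoc, Nat.add_right_comm]; exact ih.avg

theorem letH : p.Filt 0 letH := by rw [← mul_one CentralSpin.letH]; exact (one 0).small

theorem letA : p.Filt 1 p.letA := by rw [← mul_one p.letA]; exact (one 0).ann

theorem letC : p.Filt 1 p.letC := by rw [← mul_one p.letC]; exact (one 0).cre

theorem letM : p.Filt 1 p.letM := by rw [← mul_one p.letM]; exact (one 0).avg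

theorem pow (hX : p.Filt n X) (k : ℕ) : p.Filt (n * k) (X ^ k) := by
  induction k with
  | zero => rw [pow_zero]; exact one _
  | succ k ih => rw [pow_succ, Nat.mul_succ]; exact ih.mul hX

theorem commutator_mul {R : Type*} [Ring R] (a b X : R) :
    a * (b * X) - b * X * a = (a * b - b * a) * X + b * (a * X - X * a) := by noncomm_ring

/-- The commutator with `a` does not increase the number of letters. -/
theorem letA_commutator (hp : p.Admissible) (hX : p.Filt n X) :
    p.Filt n (p.letA * X - X * p.letA) := by
  induction hX with
  | spin n A => rw [letS_letA_comm, sub_self]; exact zero n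
  | @add n X Y _ _ ih1 ih2 =>
    have : p.letA * (X + Y) - (X + Y) * p.letA =
      (p.letA * X - X * p.letA) + (p.letA * Y - Y * p.letA) := by noncomm_ring
    rw [this]; exact ih1.add ih2
  | small _ ih =>
    rw [commutator_mul, ← letH_comm, sub_self, zero_mul, zero_add]; exact ih.small
  | ann _ ih => rw [commutator_mul, sub_self, zero_mul, zero_add]; exact ih.ann
  | cre h ih =>
    -- `[a, a†]` trades the letter `a†` for the letter `m_z`.
    rw [commutator_mul, letA_letC_commutator hp, smul_mul_assoc]
    exact (h.avg.smul _).add ih.cre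
  | avg h ih =>
    -- `[a, m_z]` trades `m_z` for `a`, up to factors `letH`.
    rw [commutator_mul, letA_letM_commutator, smul_mul_assoc, mul_assoc, mul_assoc]
    exact (h.ann.small.small.smul _).add ih.avg

/-- The commutator with `a†` does not increase the number of letters. -/
theorem letC_commutator (hp : p.Admissible) (hX : p.Filt n X) :
    p.Filt n (p.letC * X - X * p.letC) := by
  induction hX with
  | spin n A => rw [letS_letC_comm, sub_self]; exact zero n
  | @add n X Y _ _ ih1 ih2 =>
    have : p.letC * (X + Y) - (X + Y) * p.letC =
      (p.letC * X - X * p.letC) + (p.letC * Y - Y * p.letC) := by noncomm_ring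
    rw [this]; exact ih1.add ih2
  | small _ ih =>
    rw [commutator_mul, ← letH_comm, sub_self, zero_mul, zero_add]; exact ih.small
  | ann h ih =>
    rw [commutator_mul, ← neg_sub (p.letA * p.letC), letA_letC_commutator hp, neg_mul,
      smul_mul_assoc]
    exact (h.avg.smul _).neg.add ih.ann
  | cre _ ih => rw [commutator_mul, sub_self, zero_mul, zero_add]; exact ih.cre
  | avg h ih =>
    rw [commutator_mul, letC_letM_commutator, smul_mul_assoc, mul_assoc, mul_assoc]
    exact (h.cre.small.small.smul _).add ih.avg

end Params.Filt

/-- Sums of products of a polynomial in the letters and a local operator, with at most `n` letters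
in total. -/
inductive Params.LocFilt (p : Params) : ℕ → LocOp → Prop
  | zero (n : ℕ) : Params.LocFilt p n 0
  | add {n : ℕ} {S T : LocOp} :
      Params.LocFilt p n S → Params.LocFilt p n T → Params.LocFilt p n (S + T)
  -- The one-spin operator counts as a letter because its average may be `m_z`, `a` or `a†`.
  | mk {n : ℕ} {X : PairOp} (A : Matrix (Fin 2) (Fin 2) ℂ) :
      p.Filt n X → Params.LocFilt p (n + 1) (toLoc X * locS A)

namespace Params.LocFilt

variable {p : Params} {n m : ℕ} {X Y : PairOp} {S T : LocOp}

theorem mono (hT : p.LocFilt n T) (h : n ≤ m) : p.LocFilt m T := by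
  induction hT with
  | zero n => exact zero m
  | add _ _ ih1 ih2 => exact add (ih1 h) (ih2 h)
  | mk A hX =>
    obtain ⟨m, rfl⟩ := Nat.exists_eq_succ_of_ne_zero (Nat.ne_of_gt ((Nat.succ_pos _).trans_le h))
    exact mk A (hX.mono (Nat.le_of_succ_le_succ h))

theorem toLoc_mul (hX : p.Filt m X) (hT : p.LocFilt n T) : p.LocFilt (m + n) (toLoc X * T) := by
  induction hT with
  | zero n => rw [mul_zero]; exact zero _
  | add _ _ ih1 ih2 => rw [mul_add]; exact ih1.add ih2
  | mk A hY => rw [← mul_assoc, ← map_mul]; exact mk A (hX.mul hY)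

theorem letH_mul (hT : p.LocFilt n T) : p.LocFilt n (toLoc letH * T) := by
  have := toLoc_mul Filt.letH hT
  rwa [Nat.zero_add] at this

theorem smul (hT : p.LocFilt n T) (c : ℂ) : p.LocFilt n (c • T) := by
  have := toLoc_mul ((Filt.one 0).smul c) hT
  rwa [Nat.zero_add, ← locOp_smul_eq] at this

/-- The bound on the commutator is a hypothesis so that the induction in `locComm` can supply it. -/
theorem locS_mul_toLoc (A : Matrix (Fin 2) (Fin 2) ℂ) (hX : p.Filt n X)
    (h : p.LocFilt n (p.locComm A X)) : p.LocFilt (n + 1) (CentralSpin.locS A * toLoc X) := by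
  rw [p.locS_mul_toLoc]
  exact (mk A hX).add (h.letH_mul.mono (Nat.le_succ n))

/-- Local commutators do not increase the number of letters. -/
theorem locComm (A : Matrix (Fin 2) (Fin 2) ℂ) (hX : p.Filt n X) :
    p.LocFilt n (p.locComm A X) := by
  induction hX generalizing A with
  | spin n B => rw [p.locComm_letS]; exact zero n
  | add _ _ ih1 ih2 => rw [p.locComm_add]; exact (ih1 A).add (ih2 A)
  | small _ ih => rw [p.locComm_mul, p.locComm_letH, zero_mul, zero_add]; exact (ih A).letH_mul
  | ann h ih =>
    -- The letter `a` becomes a one-spin operator, which also counts as one letter; it is then moved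
    -- to the right of the remaining word.
    rw [p.locComm_mul, p.locComm_letA, smul_mul_assoc]
    refine ((locS_mul_toLoc _ h (ih _)).smul _).add ?_
    rw [Nat.add_comm]; exact toLoc_mul Filt.letA (ih A)
  | cre h ih =>
    rw [p.locComm_mul, p.locComm_letC, smul_mul_assoc]
    refine ((locS_mul_toLoc _ h (ih _)).smul _).add ?_
    rw [Nat.add_comm]; exact toLoc_mul Filt.letC (ih A)
  | avg h ih =>
    rw [p.locComm_mul, p.locComm_letM, mul_assoc]
    refine (locS_mul_toLoc _ h (ih _)).letH_mul.add ?_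
    rw [Nat.add_comm]; exact toLoc_mul Filt.letM (ih A)

theorem locS_mul (B : Matrix (Fin 2) (Fin 2) ℂ) (hT : p.LocFilt n T) :
    p.LocFilt n (CentralSpin.locS B * T) := by
  induction hT with
  | zero n => rw [mul_zero]; exact zero n
  | add _ _ ih1 ih2 => rw [mul_add]; exact ih1.add ih2
  | @mk n X A hX =>
    rw [← mul_assoc, p.locS_mul_toLoc, add_mul, mul_assoc, ← CentralSpin.locS_mul, mul_assoc]
    refine (mk _ hX).add (letH_mul ?_)
    -- In every summand of the commutator the one-spin operator stands on the right and absorbs `A`.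
    -- This takes a second induction, over an arbitrary local family in place of the commutator.
    have h := locComm B hX
    clear hX
    generalize p.locComm B X = T at h
    induction h with
    | zero n => rw [zero_mul]; exact zero _
    | add _ _ ih1 ih2 => rw [add_mul]; exact ih1.add ih2
    | mk C hY =>
      rw [mul_assoc, ← CentralSpin.locS_mul]; exact (mk _ hY).mono (Nat.le_succ _)

theorem mul_toLoc (hT : p.LocFilt n T) (hY : p.Filt m Y) : p.LocFilt (n + m) (T * toLoc Y) := by
  induction hT with
  | zero n => rw [zero_mul]; exact zero _
  | add _ _ ih1 ih2 => rw [add_mul]; exact ih1.add ih2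
  | mk A hX =>
    rw [mul_assoc, Nat.add_assoc, Nat.add_comm 1]
    exact toLoc_mul hX (locS_mul_toLoc A hY (locComm A hY))

theorem mul_locS (hT : p.LocFilt n T) (B : Matrix (Fin 2) (Fin 2) ℂ) :
    p.LocFilt n (T * CentralSpin.locS B) := by
  induction hT with
  | zero n => rw [zero_mul]; exact zero n
  | add _ _ ih1 ih2 => rw [add_mul]; exact ih1.add ih2
  | mk A hX => rw [mul_assoc, ← CentralSpin.locS_mul]; exact mk _ hX

theorem mul (hS : p.LocFilt n S) (hT : p.LocFilt m T) : p.LocFilt (n + m) (S * T) := by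
  induction hT with
  | zero m => rw [mul_zero]; exact zero _
  | add _ _ ih1 ih2 => rw [mul_add]; exact ih1.add ih2
  | mk B hY =>
    rw [← mul_assoc]
    exact ((hS.mul_toLoc hY).mul_locS B).mono (by omega)

/-- Averages of local operators are polynomials in the letters. -/
theorem bathAvg (hp : p.Admissible) (hT : p.LocFilt n T) : p.Filt n (p.bathAvg T) := by
  induction hT with
  | zero n => rw [map_zero]; exact Filt.zero n
  | add _ _ ih1 ih2 => rw [map_add]; exact ih1.add ih2
  | mk A hX =>
    rw [p.bathAvg_toLoc_mul]
    refine hX.mul ?_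
    -- By linearity only the averages of `1`, `σ_z`, `σ₋`, `σ₊` matter, and each of them has at most
    -- one letter.
    obtain ⟨c, d, e, f, rfl⟩ := exists_pauli_combination A
    simp only [locS_add, locS_smul, map_add, p.bathAvg_smul, hp.bathAvg_one, hp.bathAvg_pauli,
      hp.bathAvg_lower, hp.bathAvg_raise]
    exact ((((Filt.one 1).smul c).add (Filt.letM.smul d)).add
      ((Filt.letA.small.smul _).smul e)).add ((Filt.letC.small.smul _).smul f)

end Params.LocFilt

namespace Params.Filt

variable {p : Params} {n : ℕ} {X : PairOp}

/-- The correction to the Leibniz rule does not raise the count: the local commutators of `Y` and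
`X` have at most `m` and `n` letters, and averaging preserves the total. -/
theorem bathDiss_mul (hp : p.Admissible) {Y : PairOp} {m : ℕ} (hY : p.Filt m Y)
    (hX : p.Filt n X) (dY : p.Filt m (p.bathDiss Y)) (dX : p.Filt n (p.bathDiss X)) :
    p.Filt (m + n) (p.bathDiss (Y * X)) := by
  rw [hp.bathDiss_mul]
  exact ((dY.mul hX).add (hY.mul dX)).sub (LocFilt.bathAvg hp
    ((((LocFilt.locComm _ hY).mul (LocFilt.locComm _ hX)).smul _).add
      (((LocFilt.locComm _ hY).mul (LocFilt.locComm _ hX)).smul _)))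

/-- The dissipator of the bath preserves the polynomials in the letters. -/
theorem bathDiss (hp : p.Admissible) (hX : p.Filt n X) : p.Filt n (p.bathDiss X) := by
  induction hX with
  | spin n A => rw [p.bathDiss_letS]; exact zero n
  | add _ _ ih1 ih2 => rw [p.bathDiss_add]; exact ih1.add ih2
  | @small n X h ih =>
    rw [← Nat.zero_add n]
    exact bathDiss_mul hp Filt.letH h (by rw [p.bathDiss_letH]; exact zero 0) ih
  | @ann n X h ih =>
    rw [Nat.add_comm]
    exact bathDiss_mul hp Filt.letA h (by rw [p.bathDiss_letA]; exact Filt.letA.smul _) ih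
  | @cre n X h ih =>
    rw [Nat.add_comm]
    exact bathDiss_mul hp Filt.letC h (by rw [p.bathDiss_letC]; exact Filt.letC.smul _) ih
  | @avg n X h ih =>
    rw [Nat.add_comm]
    exact bathDiss_mul hp Filt.letM h
      (by rw [hp.bathDiss_letM]; exact ((one 1).smul _).add (Filt.letM.smul _)) ih

end Params.Filt

/-! ### The generators -/

/-- The matrix of an element of the algebra of the spin-boson system. -/
def opMat : FockOp →ₗ[ℂ] BosOp := toMat (n := Fin 2 × ℕ)

theorem opMul_opMat (S T : FockOp) : opMul (opMat S) (opMat T) = opMat (S * T) :=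
  opMul_toMat (n := Fin 2 × ℕ) S T

theorem opMat_opS (A : Matrix (Fin 2) (Fin 2) ℂ) : opMat (opS A) = spinInf A := toMat_spinE A

theorem opMat_opA : opMat opA = bosInf a := toMat_annE

theorem opMat_opC : opMat opC = bosInf aᴴ := toMat_creE

theorem opPow_opMat (T : FockOp) (k : ℕ) : opPow (opMat T) k = opMat (T ^ k) :=
  opPow_toMat (n := Fin 2 × ℕ) T k

theorem dissipatorInf_opMat {V W : FockOp} (h : (opMat V)ᴴ = opMat W) (X : FockOp) :
    dissipatorInf (opMat V) (opMat X) = opMat (lindblad V W X) :=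
  dissipatorInf_toMat (n := Fin 2 × ℕ) h X

/-- The Hamiltonians of the finite systems and of the spin-boson system. -/
def Params.hamPair (p : Params) : PairOp :=
  letS p.Hτ + ((p.g₀ * √p.ε : ℝ) : ℂ) • (letS raise * p.letA + letS lower * p.letC)

/-- The generators of the finite systems and of the spin-boson system. -/
def Params.genPair (p : Params) (X : PairOp) : PairOp :=
  Complex.I • (p.hamPair * X - X * p.hamPair)
    + ((p.γDown : ℂ) • lindblad (letS lower) (letS raise) X
      + (p.γUp : ℂ) • lindblad (letS raise) (letS lower) X)
    + p.bathDiss X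

/-- The factor `√ε` of the emergent coupling cancels against the normalization of `a_N`, leaving
`g₀/√(N + 1)`. -/
theorem Params.Admissible.hamPair_fst {p : Params} (hp : p.Admissible) (N : ℕ) :
    p.hamPair.1 N = p.hamiltonian (N + 1) := by
  change onSpin p.Hτ + ((p.g₀ * √p.ε : ℝ) : ℂ) • (onSpin raise * onBath (p.aN (N + 1)) +
    onSpin lower * onBath (p.aN (N + 1))ᴴ) = _
  rw [onBath_aN, onBath_aN_conj, Params.hamiltonian, onBath_collective, onBath_collective]
  simp only [mul_smul_comm]
  rw [← smul_add, smul_smul, ← Complex.ofReal_mul]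
  congr 3
  have := (Real.sqrt_pos.2 hp.ε_pos).ne'
  rw [hbar]
  field_simp

theorem Params.hamPair_snd (p : Params) : opMat p.hamPair.2 = p.hamiltonianInf := by
  change opMat (opS p.Hτ + ((p.g₀ * √p.ε : ℝ) : ℂ) • (opS raise * opA + opS lower * opC)) = _
  rw [map_add, map_smul, map_add, ← opMul_opMat, ← opMul_opMat, opMat_opS, opMat_opS, opMat_opS,
    opMat_opA, opMat_opC, opMul_spinInf_bosInf, opMul_spinInf_bosInf, Params.hamiltonianInf,
    add_comm (raise ⊗ₖ a)]

theorem Params.Admissible.genPair_fst {p : Params} (hp : p.Admissible) (X : PairOp) (N : ℕ) :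
    (p.genPair X).1 N = p.generator (N + 1) (X.1 N) := by
  change Complex.I • (p.hamPair.1 N * X.1 N - X.1 N * p.hamPair.1 N)
    + ((p.γDown : ℂ) • lindblad (onSpin lower) (onSpin raise) (X.1 N)
      + (p.γUp : ℂ) • lindblad (onSpin raise) (onSpin lower) (X.1 N))
    + ∑ k : Fin (N + 1), ((p.ΓDown : ℂ) • lindblad (siteOp k lower) (siteOp k raise) (X.1 N)
      + (p.ΓUp : ℂ) • lindblad (siteOp k raise) (siteOp k lower) (X.1 N)) = _
  rw [hp.hamPair_fst, Params.generator]
  simp only [dissipator_eq, conjTranspose_onSpin, conjTranspose_onBath, conjTranspose_site,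
    conjTranspose_raise]
  rfl

theorem Params.genPair_snd (p : Params) (X : PairOp) :
    opMat (p.genPair X).2 = p.generatorInf (opMat X.2) := by
  change opMat (Complex.I • (p.hamPair.2 * X.2 - X.2 * p.hamPair.2)
    + ((p.γDown : ℂ) • lindblad (opS lower) (opS raise) X.2
      + (p.γUp : ℂ) • lindblad (opS raise) (opS lower) X.2)
    + ((p.κDown : ℂ) • lindblad opA opC X.2 + (p.κUp : ℂ) • lindblad opC opA X.2)) = _
  have h1 : (opMat (opS lower))ᴴ = opMat (opS raise) := by
    rw [opMat_opS, opMat_opS, conjTranspose_spinInf, raise]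
  have h2 : (opMat (opS raise))ᴴ = opMat (opS lower) := by
    rw [← h1, Matrix.conjTranspose_conjTranspose]
  have h3 : (opMat opA)ᴴ = opMat opC := by rw [opMat_opA, opMat_opC, conjTranspose_bosInf]
  have h4 : (opMat opC)ᴴ = opMat opA := by rw [← h3, Matrix.conjTranspose_conjTranspose]
  simp only [map_add, map_smul, map_sub]
  rw [← dissipatorInf_opMat h1, ← dissipatorInf_opMat h2, ← dissipatorInf_opMat h3,
    ← dissipatorInf_opMat h4, ← opMul_opMat, ← opMul_opMat, Params.hamPair_snd, opMat_opS,
    opMat_opS, opMat_opA, opMat_opC]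
  rfl

theorem Params.Admissible.genPair_iterate_fst {p : Params} (hp : p.Admissible) (X : PairOp)
    (k N : ℕ) : (p.genPair^[k] X).1 N = (p.generator (N + 1))^[k] (X.1 N) := by
  induction k with
  | zero => rfl
  | succ k ih => rw [Function.iterate_succ_apply', hp.genPair_fst, ih, Function.iterate_succ_apply']

theorem Params.genPair_iterate_snd (p : Params) (X : PairOp) (k : ℕ) :
    opMat (p.genPair^[k] X).2 = p.generatorInf^[k] (opMat X.2) := by
  induction k with
  | zero => rfl
  | succ k ih =>
    rw [Function.iterate_succ_apply', Params.genPair_snd, ih, Function.iterate_succ_apply']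

/-- The generators map polynomials in the letters to polynomials in the letters. -/
theorem Params.Filt.genPair {p : Params} (hp : p.Admissible) {n : ℕ} {X : PairOp}
    (hX : p.Filt n X) : p.Filt (n + 1) (p.genPair X) := by
  have hH : p.Filt 1 p.hamPair := (Filt.spin 1 _).add
    (((Filt.letA.letS_mul _).add (Filt.letC.letS_mul _)).smul _)
  have hS : ∀ A, p.Filt 0 (letS A) := fun A => Filt.spin 0 A
  have hL : ∀ A B, p.Filt n (lindblad (letS A) (letS B) X) := fun A B =>
    (((hX.letS_mul B).mul (hS A))).sub
      (((show p.Filt n (letS B * letS A * X) by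
          rw [mul_assoc]; exact (hX.letS_mul A).letS_mul B).add
        (hX.mul ((hS A).letS_mul B))).smul _)
  -- The commutator with the Hamiltonian is the only term whose bound needs the additional letter.
  have h1 : p.Filt (n + 1) (p.hamPair * X - X * p.hamPair) := by
    refine Filt.sub ?_ (hX.mul hH)
    rw [Nat.add_comm]; exact hH.mul hX
  exact ((h1.smul _).add ((((hL _ _).smul _).add ((hL _ _).smul _)).mono (Nat.le_succ n))).add
    ((hX.bathDiss hp).mono (Nat.le_succ n))

theorem Params.Filt.genPair_iterate {p : Params} (hp : p.Admissible) {n : ℕ} {X : PairOp}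
    (hX : p.Filt n X) (k : ℕ) : p.Filt (n + k) (p.genPair^[k] X) := by
  induction k with
  | zero => exact hX
  | succ k ih => rw [Function.iterate_succ_apply']; exact ih.genPair hp

/-! ### Convergence of the expectations -/

/-- Ensures absolute convergence of the limiting expectations, hence their additivity and the KMS
relations on polynomials. -/
theorem Params.Filt.tame {p : Params} {n : ℕ} {X : PairOp} (hX : p.Filt n X) : Tame X.2 := by
  induction hX with
  | spin n A => exact tame_spinE A
  | add _ _ ih1 ih2 => exact ih1.add ih2
  | small _ _ =>
    rw [letH_mul_snd, ← zero_smul ℂ (opS 1)]; exact (tame_spinE 1).smul 0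
  | ann _ ih => exact tame_annE.mul ih
  | cre _ ih => exact tame_creE.mul ih
  | @avg n X _ ih =>
    have h : (p.letM * X).2 = (-p.ε : ℂ) • X.2 := by
      change ((-p.ε : ℂ) • (1 : FockOp)) * X.2 = _
      rw [smul_mul_assoc, one_mul]
    rw [h]; exact Tame.smul _ ih

/-- The expectation of the operator of the limiting system. -/
def Params.limitState (p : Params) (ρ : Matrix (Fin 2) (Fin 2) ℂ) (T : FockOp) : ℂ :=
  p.stateInf ρ (opMat T)

/-- The expectations in the finite systems converge to the expectation in the limiting system. -/
def Params.Converges (p : Params) (ρ : Matrix (Fin 2) (Fin 2) ℂ) (X : PairOp) : Prop :=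
  Tendsto (fun N => p.stateN ρ (N + 1) (X.1 N)) atTop (𝓝 (p.limitState ρ X.2))

section Expectations

variable {p : Params} (ρ : Matrix (Fin 2) (Fin 2) ℂ)

theorem Params.limitState_smul (c : ℂ) (T : FockOp) :
    p.limitState ρ (c • T) = c * p.limitState ρ T :=
  Params.Admissible.stateInf_smul ρ c T

theorem Params.Admissible.limitState_sub (hp : p.Admissible) {S T : FockOp} (hS : Tame S)
    (hT : Tame T) : p.limitState ρ (S - T) = p.limitState ρ S - p.limitState ρ T :=
  hp.stateInf_sub ρ hS hT

theorem Params.Admissible.stateN_mul_aN (hp : p.Admissible) (N : ℕ) (X : FinOp (N + 1)) :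
    p.stateN ρ (N + 1) (X * onBath (p.aN (N + 1))) =
      p.boltzmann * p.stateN ρ (N + 1) (onBath (p.aN (N + 1)) * X) := by
  rw [onBath_aN, mul_smul_comm, smul_mul_assoc, Params.stateN_smul, Params.stateN_smul,
    Finset.mul_sum, Finset.sum_mul, Params.stateN_sum, Params.stateN_sum]
  simp only [hp.stateN_mul_lower, ← Finset.mul_sum]
  ring

theorem Params.Admissible.stateN_aN_conj_mul (hp : p.Admissible) (N : ℕ) (X : FinOp (N + 1)) :
    p.stateN ρ (N + 1) (onBath (p.aN (N + 1))ᴴ * X) =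
      p.boltzmann * p.stateN ρ (N + 1) (X * onBath (p.aN (N + 1))ᴴ) := by
  rw [onBath_aN_conj, mul_smul_comm, smul_mul_assoc, Params.stateN_smul, Params.stateN_smul,
    Finset.mul_sum, Finset.sum_mul, Params.stateN_sum, Params.stateN_sum]
  simp only [hp.stateN_raise_mul, ← Finset.mul_sum]
  ring

/-- The site average of `stateN_pauli_add`. An unscaled commutator is `hbar N` times a scaled one,
so `m_z` acts as `-ε` up to `hbar N` times the expectation of another polynomial. -/
theorem Params.Admissible.stateN_mz_mul (hp : p.Admissible) (N : ℕ) (X : PairOp) :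
    p.stateN ρ (N + 1) (onBath (mz (N + 1)) * X.1 N) =
      -p.ε * p.stateN ρ (N + 1) (X.1 N) - 2 * (p.ΓUp / p.ΓPlus : ℝ) * (hbar N *
        p.stateN ρ (N + 1) ((p.bathAvg (locS lower * p.locComm raise X)).1 N)) := by
  have hN : (hbar N : ℂ) ^ 2 * (N + 1 : ℕ) = 1 := by
    rw [← Complex.ofReal_pow, hbar_sq]
    have : ((N + 1 : ℕ) : ℂ) ≠ 0 := by exact_mod_cast N.succ_ne_zero
    push_cast at this ⊢
    rw [one_div_mul_cancel this]
  have h : ∀ k : Fin (N + 1), p.stateN ρ (N + 1) (siteOp k lower *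
      ((hbar N : ℂ)⁻¹ • (siteOp k raise * X.1 N - X.1 N * siteOp k raise))) =
      -(hbar N : ℂ)⁻¹ * p.stateN ρ (N + 1)
        (siteOp k lower * (X.1 N * siteOp k raise - siteOp k raise * X.1 N)) := by
    intro k
    rw [mul_smul_comm, Params.stateN_smul, ← neg_sub (X.1 N * siteOp k raise), mul_neg,
      ← neg_one_smul ℂ (siteOp k lower * _), Params.stateN_smul]
    ring
  have h1 : p.stateN ρ (N + 1) ((p.bathAvg (locS lower * p.locComm raise X)).1 N) =
      -(hbar N : ℂ) * ∑ k : Fin (N + 1), p.stateN ρ (N + 1)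
        (siteOp k lower * (X.1 N * siteOp k raise - siteOp k raise * X.1 N)) := by
    change p.stateN ρ (N + 1) (((hbar N ^ 2 : ℝ) : ℂ) • ∑ k : Fin (N + 1), siteOp k lower *
      ((hbar N : ℂ)⁻¹ • (siteOp k raise * X.1 N - X.1 N * siteOp k raise))) = _
    rw [Params.stateN_smul, Params.stateN_sum]
    simp only [h, ← Finset.mul_sum]
    rw [← mul_assoc]
    congr 1
    have := hbar_ne_zero N
    push_cast; field_simp
  have h2 : ∑ k : Fin (N + 1), (p.stateN ρ (N + 1) (siteOp k (pauli 3) * X.1 N) +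
      p.ε * p.stateN ρ (N + 1) (X.1 N)) =
      2 * (p.ΓUp / p.ΓPlus : ℝ) * ∑ k : Fin (N + 1), p.stateN ρ (N + 1)
        (siteOp k lower * (X.1 N * siteOp k raise - siteOp k raise * X.1 N)) := by
    rw [Finset.mul_sum]
    exact Finset.sum_congr rfl fun k _ => hp.stateN_pauli_add ρ k _
  rw [Finset.sum_add_distrib, Finset.sum_const, Finset.card_univ, Fintype.card_fin,
    nsmul_eq_mul] at h2
  rw [h1, onBath_mz, smul_mul_assoc, Params.stateN_smul, Finset.sum_mul, Params.stateN_sum]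
  push_cast at h2 hN ⊢
  linear_combination ((hbar N : ℂ) ^ 2) * h2 - p.ε * p.stateN ρ (N + 1) (X.1 N) * hN

theorem Params.Admissible.one_sub_boltzmann_ne_zero (hp : p.Admissible) :
    (1 : ℂ) - p.boltzmann ≠ 0 := by
  exact_mod_cast (sub_pos.2 hp.boltzmann_lt_one).ne'

/-- Structural induction treats sums and factors `letH`; `IH` enters only when a counted letter is
in front. Each such letter is removed by one relation that holds in both systems with the same
coefficients. -/
theorem Params.Filt.converges_step (hp : p.Admissible) {n : ℕ} {X : PairOp} (hX : p.Filt n X)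
    (IH : ∀ m < n, ∀ Y, p.Filt m Y → p.Converges ρ Y) : p.Converges ρ X := by
  have hb := hp.one_sub_boltzmann_ne_zero
  induction hX with
  | spin n A =>
    have h : p.limitState ρ (opS A) = (ρ * A).trace := hp.stateInf_spinE ρ A
    refine Tendsto.congr (fun N => (hp.stateN_onSpin ρ A).symm) ?_
    change Tendsto _ _ (𝓝 (p.limitState ρ (opS A)))
    rw [h]
    exact tendsto_const_nhds
  | @add n X Y hX hY ih1 ih2 =>
    have h : p.limitState ρ (X + Y).2 = p.limitState ρ X.2 + p.limitState ρ Y.2 :=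
      hp.stateInf_add ρ hX.tame hY.tame
    rw [Params.Converges, h]
    exact ((ih1 IH).add (ih2 IH)).congr fun N => (p.stateN_add ρ (N + 1) _ _).symm
  | @small n X hX ih =>
    have h : p.limitState ρ (CentralSpin.letH * X).2 = (0 : ℂ) * p.limitState ρ X.2 := by
      rw [letH_mul_snd, ← zero_smul ℂ X.2, Params.limitState_smul]
    rw [Params.Converges, h]
    have h0 : Tendsto (fun N => (hbar N : ℂ)) atTop (𝓝 0) := by
      have := (Complex.continuous_ofReal.tendsto 0).comp hbar_tendsto
      rwa [Complex.ofReal_zero] at this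
    exact (h0.mul (ih IH)).congr fun N => by rw [letH_mul_fst, Params.stateN_smul]
  | @ann n X hX _ =>
    -- KMS gives `⟨[a, X]⟩ = (1 - b) ⟨a X⟩`, and the commutator has at most `n` letters, against `n
    -- + 1` for `a X`.
    have hc := IH n (Nat.lt_succ_self n) _ (hX.letA_commutator hp)
    have h1 : p.limitState ρ (opA * X.2) =
        (1 - p.boltzmann : ℂ)⁻¹ * p.limitState ρ (p.letA * X - X * p.letA).2 := by
      have e1 : p.limitState ρ (p.letA * X - X * p.letA).2 =
        p.limitState ρ (opA * X.2) - p.limitState ρ (X.2 * opA) :=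
        hp.limitState_sub ρ (tame_annE.mul hX.tame) (Tame.mul hX.tame tame_annE)
      have e2 : p.limitState ρ (X.2 * opA) = p.boltzmann * p.limitState ρ (opA * X.2) :=
        hp.stateInf_mul_annE ρ hX.tame
      rw [e1, e2]; field_simp
    change Tendsto _ _ (𝓝 (p.limitState ρ (opA * X.2)))
    rw [h1]
    refine (hc.const_mul _).congr fun N => ?_
    have e1 : p.stateN ρ (N + 1) ((p.letA * X - X * p.letA).1 N) =
        p.stateN ρ (N + 1) (onBath (p.aN (N + 1)) * X.1 N) -
          p.stateN ρ (N + 1) (X.1 N * onBath (p.aN (N + 1))) := p.stateN_sub ρ (N + 1) _ _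
    rw [e1, hp.stateN_mul_aN]
    change _ = p.stateN ρ (N + 1) (onBath (p.aN (N + 1)) * X.1 N)
    field_simp
  | @cre n X hX _ =>
    have hc := IH n (Nat.lt_succ_self n) _ (hX.letC_commutator hp)
    -- Here `⟨[a†, X]⟩ = (b - 1) ⟨X a†⟩` and `⟨a† X⟩ = b ⟨X a†⟩`. The coefficient `-b/(1 - b)`
    -- avoids division by `b`, which is `0` when `Γ_up = 0`.
    have h1 : p.limitState ρ (opC * X.2) =
        (-p.boltzmann / (1 - p.boltzmann) : ℂ) *
          p.limitState ρ (p.letC * X - X * p.letC).2 := by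
      have e1 : p.limitState ρ (p.letC * X - X * p.letC).2 =
        p.limitState ρ (opC * X.2) - p.limitState ρ (X.2 * opC) :=
        hp.limitState_sub ρ (tame_creE.mul hX.tame) (Tame.mul hX.tame tame_creE)
      have e2 : p.limitState ρ (opC * X.2) = p.boltzmann * p.limitState ρ (X.2 * opC) :=
        hp.stateInf_creE_mul ρ hX.tame
      rw [e1, e2]; field_simp; ring
    change Tendsto _ _ (𝓝 (p.limitState ρ (opC * X.2)))
    rw [h1]
    refine (hc.const_mul _).congr fun N => ?_
    have e1 : p.stateN ρ (N + 1) ((p.letC * X - X * p.letC).1 N) =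
        p.stateN ρ (N + 1) (onBath (p.aN (N + 1))ᴴ * X.1 N) -
          p.stateN ρ (N + 1) (X.1 N * onBath (p.aN (N + 1))ᴴ) := p.stateN_sub ρ (N + 1) _ _
    rw [e1]
    change _ = p.stateN ρ (N + 1) (onBath (p.aN (N + 1))ᴴ * X.1 N)
    rw [hp.stateN_aN_conj_mul]
    field_simp; ring
  | @avg n X hX _ =>
    have hc := IH n (Nat.lt_succ_self n) _ hX
    -- The error term is `letH` times a polynomial with at most `n` letters, so it converges, and to
    -- `0`.
    have hz := IH n (Nat.lt_succ_self n) _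
      (LocFilt.bathAvg hp ((LocFilt.locComm raise hX).locS_mul lower)).small
    have h1 : p.limitState ρ (p.letM * X).2 = -p.ε * p.limitState ρ X.2 -
        2 * (p.ΓUp / p.ΓPlus : ℝ) * p.limitState ρ
          (CentralSpin.letH * p.bathAvg (locS lower * p.locComm raise X)).2 := by
      have e1 : (p.letM * X).2 = (-p.ε : ℂ) • X.2 := by
        change ((-p.ε : ℂ) • (1 : FockOp)) * X.2 = _
        rw [smul_mul_assoc, one_mul]
      rw [e1, letH_mul_snd, ← zero_smul ℂ X.2, Params.limitState_smul, Params.limitState_smul]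
      ring
    rw [Params.Converges, h1]
    refine ((hc.const_mul _).sub (hz.const_mul _)).congr fun N => ?_
    rw [letH_mul_fst, Params.stateN_smul]
    exact (hp.stateN_mz_mul ρ N X).symm

/-- The expectations of a polynomial in the letters converge. -/
theorem Params.Filt.converges (hp : p.Admissible) {n : ℕ} {X : PairOp} (hX : p.Filt n X) :
    p.Converges ρ X := by
  induction n using Nat.strong_induction_on generalizing X with
  | _ n IH => exact hX.converges_step ρ hp fun m hm Y hY => IH m hm hY

end Expectations

/-! ### Monomials -/

/-- The monomials `P_N^μ` and their limit `P^μ`. -/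
def Params.monPair (p : Params) (μ : MonIndex) : PairOp :=
  letS (pauli μ.spin) * (p.letC ^ μ.cre * p.letA ^ μ.ann * p.letM ^ μ.avg)

theorem Params.monPair_fst (p : Params) (μ : MonIndex) (N : ℕ) :
    (p.monPair μ).1 N = p.monN (N + 1) μ := by
  rw [Params.monN, onBath_mul, onBath_mul, onBath_pow, onBath_pow, onBath_pow]
  rfl

theorem Params.monPair_snd (p : Params) (μ : MonIndex) : opMat (p.monPair μ).2 = p.monInf μ := by
  change opMat (opS (pauli μ.spin) * (opC ^ μ.cre * opA ^ μ.ann * ((-p.ε : ℂ) • 1) ^ μ.avg)) = _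
  rw [smul_pow, one_pow, mul_smul_comm, mul_smul_comm, mul_one, map_smul, ← opMul_opMat,
    ← opMul_opMat, ← opPow_opMat, ← opPow_opMat, opMat_opS, opMat_opA, opMat_opC, opPow_bosInf,
    opPow_bosInf, opMul_bosInf, opMul_spinInf_bosInf, Params.monInf]
  push_cast
  rfl

theorem Params.filt_monPair (p : Params) (μ : MonIndex) : ∃ n, p.Filt n (p.monPair μ) :=
  ⟨_, (((Filt.letC.pow _).mul (Filt.letA.pow _)).mul (Filt.letM.pow _)).letS_mul _⟩

/-- Convergence of the correlation functions of `𝓛ᵏ[P_N^μ]` for fixed `k`. -/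
theorem Params.Admissible.tendsto_corrN {p : Params} (hp : p.Admissible)
    (ρ : Matrix (Fin 2) (Fin 2) ℂ) (ν μ η : MonIndex) (k : ℕ) :
    Tendsto (fun N : ℕ => p.corrN ρ N ν η ((p.generator N)^[k] (p.monN N μ))) atTop
      (𝓝 (p.corrInf ρ ν η (p.generatorInf^[k] (p.monInf μ)))) := by
  obtain ⟨n₁, h₁⟩ := p.filt_monPair ν
  obtain ⟨n₂, h₂⟩ := p.filt_monPair μ
  obtain ⟨n₃, h₃⟩ := p.filt_monPair η
  have h := ((h₁.mul (h₂.genPair_iterate hp k)).mul h₃).converges ρ hp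
  -- Pairs have `N + 1` bath spins; the empty bath does not affect the limit.
  rw [← tendsto_add_atTop_iff_nat 1]
  have e : p.limitState ρ (p.monPair ν * p.genPair^[k] (p.monPair μ) * p.monPair η).2 =
      p.corrInf ρ ν η (p.generatorInf^[k] (p.monInf μ)) := by
    rw [Params.limitState, Prod.snd_mul, Prod.snd_mul, ← opMul_opMat, ← opMul_opMat,
      p.genPair_iterate_snd, p.monPair_snd, p.monPair_snd, p.monPair_snd]
    rfl
  rw [Params.Converges, e] at h
  refine h.congr fun N => ?_
  rw [Params.corrN, ← p.monPair_fst, ← p.monPair_fst, ← p.monPair_fst, ← hp.genPair_iterate_fst]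
  rfl

end CentralSpin

end

/-! ### Exchange of the limit with the exponential series -/

theorem corollary1 (p : CentralSpin.Params)
    (hγUp : 0 ≤ p.γUp) (hγDown : 0 ≤ p.γDown) (hΓUp : 0 ≤ p.ΓUp) (hΓ : p.ΓUp < p.ΓDown)
    (ρ : Matrix (Fin 2) (Fin 2) ℂ) (hρ : ρ.PosSemidef) (hρtr : ρ.trace = 1)
    (ν μ η : CentralSpin.MonIndex)
    (hA1 : p.A1 ρ ν μ η) (hA2 : p.A2 ρ ν μ η) (t : ℝ) (ht : 0 ≤ t) :
    Tendsto
      (fun N : ℕ => p.corrN ρ N ν η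
        (CentralSpin.expSeries (p.generator N) t (p.monN N μ)))
      atTop
      (𝓝 (p.corrInf ρ ν η (CentralSpin.expSeries p.generatorInf t (p.monInf μ)))) := by
  have hp : p.Admissible := ⟨hΓUp, hΓ⟩
  obtain ⟨S, hS, hlim⟩ := hA1 t ht _ (hp.tendsto_corrN ρ ν μ η)
  -- On the compact set `{t}`, (A2) says that the partial sums for which (A1) gives the limit `S`
  -- also converge to the emergent correlation function.
  have h := (hA2.2 {t} (Set.singleton_subset_iff.2 ht) isCompact_singleton).tendsto_at
    (Set.mem_singleton t)
  rwa [tendsto_nhds_unique h hS]
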